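/- Let $I$ be a set and let $1\le p<\infty$, with conjugate exponent $p^*$ given by $\frac1p+\frac1{p^*}=1$. For $1\le q<\infty$ let $S_q^I$ be the space of compact operators $A$ on $\ell_2^I$ (over $\mathbb C$) with $\|A\|_{S_q^I}=\big(\operatorname{Tr}\,(A^*A)^{q/2}\big)^{1/q}<\infty$, and let $S_\infty^I$ be the space of compact operators on $\ell_2^I$ with the operator norm. Identify operators with their $I\times I$ matrices, and for $I\times I$ matrices write $A*B=[a_{ij}b_{ij}]_{i,j\in I}$ for the Schur product. Let $S_p^I\otimes_\gamma S_{p^*}^I$ be the (completed) Banach space projective tensor product, let $\varphi_p^I$ be the linear map from $S_p^I\otimes_\gamma S_{p^*}^I$ to matrices obtained by continuous extension from $A\otimes B\mapsto A*B$, and let $\mathfrak R_p^I$ be the space of matrices $\operatorname{Im}\varphi_p^I$, equipped with the norm of the quotient $\big(S_p^I\otimes_\gamma S_{p^*}^I\big)/\operatorname{Ker}\varphi_p^I$. **Proposition.** The space $\mathfrak R_p^I$, equipped with the Schur product, is a commutative (not necessarily unital) complex Banach algebra. That is, $\mathfrak R_p^I$ is complete, $C*D\in\mathfrak R_p^I$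 for all $C,D\in\mathfrak R_p^I$, the product $(C,D)\mapsto C*D$ is bilinear, associative and commutative, and $$\|C*D\|_{\mathfrak R_p^I}\le\|C\|_{\mathfrak R_p^I}\,\|D\|_{\mathfrak R_p^I}\qquad(C,D\in\mathfrak R_p^I).$$ -/

import Mathlib

open scoped ENNReal NNReal InnerProductSpace Matrix TensorProduct

section SchattenHelpers

universe u

variable {H : Type u} [NormedAddCommGroup H] [InnerProductSpace ℂ H]

theorem ennreal_sum_wt_le {κ : Type*} {p : ℝ} (hp : 1 ≤ p) (w f : κ → ℝ≥0∞)
    (hw : ∑' k, w k ≤ 1) : (∑' k, w k * f k) ^ p ≤ ∑' k, w k * f k ^ p := by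
  have hp0 : 0 < p := by linarith
  rw [← ENNReal.le_rpow_inv_iff hp0, ENNReal.tsum_eq_iSup_sum]
  refine iSup_le fun s => ?_
  refine (ENNReal.inner_le_weight_mul_Lp_of_nonneg s hp w f).trans ?_
  have h1 : (∑ i ∈ s, w i) ^ (1 - p⁻¹) ≤ 1 := by
    refine ENNReal.rpow_le_one ((ENNReal.sum_le_tsum s).trans hw) ?_
    have := inv_le_one_of_one_le₀ hp
    linarith
  calc _ ≤ 1 * (∑ i ∈ s, w i * f i ^ p) ^ p⁻¹ := by gcongr
    _ ≤ _ := by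
      rw [one_mul]
      gcongr
      exact ENNReal.sum_le_tsum s

theorem ennreal_tsum_add_le {κ : Type*} {p : ℝ} (hp : 1 ≤ p) (f g : κ → ℝ≥0∞) :
    (∑' k, (f k + g k) ^ p) ^ (1 / p) ≤
      (∑' k, f k ^ p) ^ (1 / p) + (∑' k, g k ^ p) ^ (1 / p) := by
  have hp0 : 0 < p := by linarith
  rw [one_div, ENNReal.rpow_inv_le_iff hp0, ENNReal.tsum_eq_iSup_sum]
  refine iSup_le fun s => ?_
  rw [← ENNReal.rpow_inv_le_iff hp0, ← one_div]
  refine (ENNReal.Lp_add_le s f g hp).trans ?_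
  gcongr <;> exact ENNReal.sum_le_tsum s

theorem parseval_enorm {κ : Type*} (b : HilbertBasis κ ℂ H) (x : H) :
    ∑' k, ‖⟪b k, x⟫_ℂ‖ₑ ^ 2 = ‖x‖ₑ ^ 2 := by
  have h := b.hasSum_inner_mul_inner x x
  have h2 : HasSum (fun k => ‖⟪b k, x⟫_ℂ‖ ^ 2) (‖x‖ ^ 2) := by
    have := Complex.hasSum_re h
    convert this using 1
    · ext k
      rw [← inner_conj_symm x (b k), ← Complex.normSq_eq_conj_mul_self, Complex.normSq_eq_norm_sq]
      simp [← Complex.ofReal_pow]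
    · rw [inner_self_eq_norm_sq_to_K]; simp [← Complex.ofReal_pow]
  have h3 := ENNReal.ofReal_tsum_of_nonneg (fun k => by positivity) h2.summable
  rw [h2.tsum_eq] at h3
  simpa [ENNReal.ofReal_pow, ofReal_norm] using h3.symm

theorem bessel_enorm {κ : Type*} {v : κ → H} (hv : Orthonormal ℂ v) (x : H) :
    ∑' k, ‖⟪v k, x⟫_ℂ‖ₑ ^ 2 ≤ ‖x‖ₑ ^ 2 := by
  rw [ENNReal.tsum_eq_iSup_sum]
  refine iSup_le fun s => ?_
  have := ENNReal.ofReal_le_ofReal (hv.sum_inner_products_le x (s := s))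
  rw [ENNReal.ofReal_sum_of_nonneg (fun _ _ => by positivity)] at this
  simpa [ENNReal.ofReal_pow, ofReal_norm] using this

variable [CompleteSpace H]

theorem exists_eigenbasis (T : H →L[ℂ] H) (hc : IsCompactOperator T) (hs : T.IsSymmetric) :
    ∃ (κ : Type u) (b : HilbertBasis κ ℂ H) (l : κ → ℂ), ∀ k, T (b k) = l k • b k := by
  let V := fun μ : ℂ => Module.End.eigenspace (T : Module.End ℂ H) μ
  have hcl : ∀ μ, IsClosed (V μ : Set H) := by
    intro μ
    have : (V μ : Set H) = {x | T x = μ • x} := by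
      ext x; simp [V]
    rw [this]
    exact isClosed_eq T.continuous (by fun_prop)
  have : ∀ μ, CompleteSpace (V μ) := fun μ => (hcl μ).completeSpace_coe
  choose w b hb using fun μ => exists_hilbertBasis ℂ (V μ)
  have hon := (hs.orthogonalFamily_eigenspaces).orthonormal_sigma_orthonormal
    (fun μ => (b μ).orthonormal)
  refine ⟨Σ μ, w μ, HilbertBasis.mkOfOrthogonalEqBot hon ?_, fun k => k.1, ?_⟩
  · rw [← T.orthogonalComplement_iSup_eigenspaces_eq_bot hc hs]
    refine le_antisymm ?_ ?_
    · rw [T.orthogonalComplement_iSup_eigenspaces_eq_bot hc hs]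
      intro x hx
      rw [← T.orthogonalComplement_iSup_eigenspaces_eq_bot hc hs, ← Submodule.iInf_orthogonal]
      rw [Submodule.mem_iInf]
      intro μ
      rw [Submodule.mem_orthogonal]
      intro u hu
      have hx' : ∀ k : Σ μ, w μ, ⟪((b k.1 k.2 : V k.1) : H), x⟫_ℂ = 0 := fun k =>
        (Submodule.mem_orthogonal _ _).1 hx _ (Submodule.subset_span ⟨k, rfl⟩)
      have hd := (b μ).dense_span
      have : ∀ z : V μ, ⟪(z : H), x⟫_ℂ = 0 := by
        intro z
        have hz : z ∈ (Submodule.span ℂ (Set.range (b μ))).topologicalClosure := by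
          rw [hd]; trivial
        have hle : (Submodule.span ℂ (Set.range (b μ))).topologicalClosure ≤
            LinearMap.ker ((innerSL ℂ x).comp (V μ).subtypeL).toLinearMap := by
          refine Submodule.topologicalClosure_minimal _ ?_ ?_
          · rw [Submodule.span_le]
            rintro _ ⟨k, rfl⟩
            have := hx' ⟨μ, k⟩
            rw [inner_eq_zero_symm] at this
            simpa using this
          · exact ContinuousLinearMap.isClosed_ker _
        have := hle hz
        rw [inner_eq_zero_symm]
        simpa using this
      exact this ⟨u, hu⟩
    · rw [T.orthogonalComplement_iSup_eigenspaces_eq_bot hc hs]; exact bot_le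
  · rintro ⟨μ, k⟩
    simp only [HilbertBasis.coe_mkOfOrthogonalEqBot]
    exact Module.End.mem_eigenspace_iff.1 (b μ k).2

theorem cfc_apply_eigenvector (T : H →L[ℂ] H) (hT : IsSelfAdjoint T) (f : ℝ → ℝ)
    (hf : ContinuousOn f (spectrum ℝ T)) {v : H} {l : ℝ} (hv : T v = (l : ℂ) • v) (hl : v ≠ 0) :
    cfc f T v = (f l : ℂ) • v := by
  have hmem : l ∈ spectrum ℝ T := by
    rw [spectrum.mem_iff]
    intro hu
    obtain ⟨u, hu⟩ := hu
    have h0 : (u : H →L[ℂ] H) v = 0 := by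
      rw [hu, sub_apply, hv, Algebra.algebraMap_eq_smul_one]
      simp
    have : ((u⁻¹ : (H →L[ℂ] H)ˣ) : H →L[ℂ] H) ((u : H →L[ℂ] H) v) = v := by
      rw [← mul_apply_eq_comp, Units.inv_mul]; rfl
    rw [h0, map_zero] at this
    exact hl this.symm
  have key : ∀ g : C(spectrum ℝ T, ℝ), cfcHom hT g v = (g ⟨l, hmem⟩ : ℂ) • v := by
    intro g
    induction g using ContinuousMap.induction_on_of_compact with
    | const r =>
      have : (ContinuousMap.const (spectrum ℝ T) r) = algebraMap ℝ C(spectrum ℝ T, ℝ) r := rfl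
      rw [this, AlgHomClass.commutes, Algebra.algebraMap_eq_smul_one]
      simp
    | id => rw [cfcHom_id hT, hv]; simp
    | star_id => rw [map_star, cfcHom_id hT, hT.star_eq, hv]; simp
    | add f g hf hg => rw [map_add, add_apply, hf, hg, ← add_smul]; simp
    | mul f g hf hg =>
      rw [map_mul, mul_apply_eq_comp, hg, map_smul, hf, smul_smul]
      simp [mul_comm]
    | frequently f h =>
      refine isClosed_iff_frequently.1 (isClosed_eq (f := fun g => cfcHom hT g v)
        (g := fun g : C(spectrum ℝ T, ℝ) => (g ⟨l, hmem⟩ : ℂ) • v) ?_ ?_) f h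
      · exact (ContinuousLinearMap.apply ℂ H v).continuous.comp (cfcHom_continuous hT)
      · fun_prop
  rw [cfc_apply f T, key]
  rfl

theorem trace_indep {ι κ : Type*} (e : HilbertBasis ι ℂ H) (b : HilbertBasis κ ℂ H)
    (P : H →L[ℂ] H) (hP : 0 ≤ P) :
    ∑' i, ENNReal.ofReal (⟪e i, P (e i)⟫_ℂ).re = ∑' k, ENNReal.ofReal (⟪b k, P (b k)⟫_ℂ).re := by
  obtain ⟨S, hS, hSP⟩ : ∃ S : H →L[ℂ] H, IsSelfAdjoint S ∧ S * S = P :=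
    ⟨CFC.sqrt P, (CFC.sqrt_nonneg P).isSelfAdjoint, CFC.sqrt_mul_sqrt_self P⟩
  have hsym : ∀ x y, ⟪S x, y⟫_ℂ = ⟪x, S y⟫_ℂ :=
    (ContinuousLinearMap.isSelfAdjoint_iff_isSymmetric.1 hS)
  have h1 : ∀ x : H, ENNReal.ofReal (⟪x, P x⟫_ℂ).re = ‖S x‖ₑ ^ 2 := by
    intro x
    rw [← hSP, mul_apply_eq_comp, ← hsym, inner_self_eq_norm_sq_to_K,
      ← ofReal_norm, ← ENNReal.ofReal_pow (norm_nonneg _)]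
    simp [← Complex.ofReal_pow]
  simp_rw [h1]
  calc ∑' i, ‖S (e i)‖ₑ ^ 2 = ∑' i, ∑' k, ‖⟪b k, S (e i)⟫_ℂ‖ₑ ^ 2 := by
        simp_rw [parseval_enorm b]
    _ = ∑' k, ∑' i, ‖⟪b k, S (e i)⟫_ℂ‖ₑ ^ 2 := ENNReal.tsum_comm
    _ = ∑' k, ∑' i, ‖⟪e i, S (b k)⟫_ℂ‖ₑ ^ 2 := by
        refine tsum_congr fun k => tsum_congr fun i => ?_
        rw [← hsym, ← inner_conj_symm, RCLike.enorm_conj]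
    _ = _ := by simp_rw [parseval_enorm e]

/-- Singular values: an orthonormal basis of eigenvectors of `A† A`. -/
def SingularSystem {κ : Type*} (A : H →L[ℂ] H) (b : HilbertBasis κ ℂ H) (s : κ → ℝ≥0) : Prop :=
  ∀ k, (star A * A) (b k) = (((s k : ℝ) ^ 2 : ℝ) : ℂ) • b k

theorem exists_singularSystem (A : H →L[ℂ] H) (hA : IsCompactOperator A) :
    ∃ (κ : Type u) (b : HilbertBasis κ ℂ H) (s : κ → ℝ≥0), SingularSystem A b s := by
  obtain ⟨κ, b, l, hb⟩ := exists_eigenbasis (star A * A) (hA.clm_comp (star A))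
    (ContinuousLinearMap.isSelfAdjoint_iff_isSymmetric.1 (IsSelfAdjoint.star_mul_self A))
  refine ⟨κ, b, fun k => ‖A (b k)‖₊, fun k => ?_⟩
  have h1 : ⟪b k, (star A * A) (b k)⟫_ℂ = ((‖A (b k)‖ ^ 2 : ℝ) : ℂ) := by
    rw [mul_apply_eq_comp, ContinuousLinearMap.star_eq_adjoint,
      ContinuousLinearMap.adjoint_inner_right, inner_self_eq_norm_sq_to_K]
    simp
  rw [hb, inner_smul_right, inner_self_eq_norm_sq_to_K, b.orthonormal.1 k] at h1
  rw [hb, show l k = _ by simpa using h1]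
  simp

theorem SingularSystem.inner {κ : Type*} {A : H →L[ℂ] H} {b : HilbertBasis κ ℂ H} {s : κ → ℝ≥0}
    (h : SingularSystem A b s) (j k : κ) :
    ⟪A (b j), A (b k)⟫_ℂ = (((s k : ℝ) ^ 2 : ℝ) : ℂ) * ⟪b j, b k⟫_ℂ := by
  rw [← ContinuousLinearMap.adjoint_inner_right, ← ContinuousLinearMap.star_eq_adjoint,
    ← mul_apply_eq_comp, h k, inner_smul_right]

theorem SingularSystem.trace_eq {ι κ : Type*} {A : H →L[ℂ] H} {b : HilbertBasis κ ℂ H}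
    {s : κ → ℝ≥0} (h : SingularSystem A b s) (e : HilbertBasis ι ℂ H) {p : ℝ} (hp : 0 < p) :
    ∑' i, ENNReal.ofReal (⟪e i, ((star A * A) ^ (p / 2)) (e i)⟫_ℂ).re =
      ∑' k, (s k : ℝ≥0∞) ^ p := by
  have hT : 0 ≤ star A * A := star_mul_self_nonneg A
  rw [trace_indep e b _ CFC.rpow_nonneg]
  refine tsum_congr fun k => ?_
  rw [CFC.rpow_eq_cfc_real hT, cfc_apply_eigenvector _ hT.isSelfAdjoint _ ?_ (h k)
    (b.orthonormal.ne_zero k), inner_smul_right, inner_self_eq_norm_sq_to_K, b.orthonormal.1 k]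
  · have : ((s k : ℝ) ^ 2) ^ (p / 2) = (s k : ℝ) ^ p := by
      rw [← Real.rpow_natCast, ← Real.rpow_mul (by positivity)]
      congr 1; push_cast; ring
    simp only [this]
    rw [← ENNReal.ofReal_coe_nnreal, ENNReal.ofReal_rpow_of_nonneg (by positivity) hp.le]
    simp
  · exact (Real.continuous_rpow_const (by positivity)).continuousOn

theorem SingularSystem.orthonormal_left {κ : Type*} {A : H →L[ℂ] H} {b : HilbertBasis κ ℂ H}
    {s : κ → ℝ≥0} (h : SingularSystem A b s) :
    Orthonormal ℂ (fun k : {k // s k ≠ 0} => ((s k : ℝ)⁻¹ : ℂ) • A (b k)) := by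
  classical
    rw [orthonormal_iff_ite]
    rintro ⟨j, hj⟩ ⟨k, hk⟩
    have hk' : ((s k : ℝ) : ℂ) ≠ 0 := by simpa using hk
    have hj' : ((s j : ℝ) : ℂ) ≠ 0 := by simpa using hj
    simp only [inner_smul_left, inner_smul_right, h.inner j k,
      (orthonormal_iff_ite.1 b.orthonormal) j k, Subtype.mk.injEq]
    split_ifs with hjk
    · subst hjk
      simp only [map_inv₀, Complex.conj_ofReal]
      push_cast
      field_simp
    · simp

theorem SingularSystem.tsum_le {κ τ : Type*} {A : H →L[ℂ] H} {b : HilbertBasis κ ℂ H}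
    {s : κ → ℝ≥0} (h : SingularSystem A b s) {e f : τ → H} (he : Orthonormal ℂ e)
    (hf : Orthonormal ℂ f) {p : ℝ} (hp : 1 ≤ p) :
    ∑' t, ‖⟪f t, A (e t)⟫_ℂ‖ₑ ^ p ≤ ∑' k, (s k : ℝ≥0∞) ^ p := by
  classical
  -- left singular vectors, zero where the singular value vanishes
  let u : κ → H := fun k => ((s k : ℝ)⁻¹ : ℂ) • A (b k)
  have hAb : ∀ k, A (b k) = ((s k : ℝ) : ℂ) • u k := by
    intro k
    by_cases hk : s k = 0
    · have := h.inner k k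
      rw [hk] at this
      simpa [hk] using this
    · have : ((s k : ℝ) : ℂ) ≠ 0 := by simpa using hk
      simp only [u]
      rw [smul_smul, mul_inv_cancel₀ this, one_smul]
  have hu : Orthonormal ℂ (fun k : {k // s k ≠ 0} => u k) := h.orthonormal_left
  have hu0 : ∀ k, s k = 0 → u k = 0 := by
    intro k hk; simp [u, hk]
  have hbessel : ∀ x : H, ∑' k, ‖⟪u k, x⟫_ℂ‖ₑ ^ 2 ≤ ‖x‖ₑ ^ 2 := by
    intro x
    refine le_trans (le_of_eq ?_) (bessel_enorm hu x)
    refine (tsum_subtype_eq_of_support_subset (s := {k | s k ≠ 0})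
      (f := fun k => ‖⟪u k, x⟫_ℂ‖ₑ ^ 2) ?_).symm
    intro k hk hk0
    apply hk
    simp [hu0 k (by simpa using hk0)]
  have hun : ∀ k, ‖u k‖ₑ ^ 2 ≤ 1 := by
    intro k
    by_cases hk : s k = 0
    · simp [hu0 k hk]
    · have := hu.1 ⟨k, hk⟩
      simp only at this
      rw [← ofReal_norm, this]; simp
  let w : τ → κ → ℝ≥0∞ := fun t k => 2⁻¹ * (‖⟪u k, f t⟫_ℂ‖ₑ ^ 2 + ‖⟪b k, e t⟫_ℂ‖ₑ ^ 2)
  have half : (2⁻¹ : ℝ≥0∞) * (1 + 1) = 1 := by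
    rw [one_add_one_eq_two]; exact ENNReal.inv_mul_cancel (by simp) (by simp)
  have hw1 : ∀ t, ∑' k, w t k ≤ 1 := by
    intro t
    simp only [w]
    rw [ENNReal.tsum_mul_left, ENNReal.tsum_add, parseval_enorm, ← half]
    gcongr
    · refine (hbessel _).trans ?_
      rw [← ofReal_norm, hf.1]; simp
    · rw [← ofReal_norm, he.1]; simp
  have hw2 : ∀ k, ∑' t, w t k ≤ 1 := by
    intro k
    simp only [w]
    rw [ENNReal.tsum_mul_left, ENNReal.tsum_add, ← half]
    gcongr
    · simp_rw [fun t => show ‖⟪u k, f t⟫_ℂ‖ₑ = ‖⟪f t, u k⟫_ℂ‖ₑ by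
        rw [← inner_conj_symm, RCLike.enorm_conj]]
      exact (bessel_enorm hf _).trans (hun k)
    · simp_rw [fun t => show ‖⟪b k, e t⟫_ℂ‖ₑ = ‖⟪e t, b k⟫_ℂ‖ₑ by
        rw [← inner_conj_symm, RCLike.enorm_conj]]
      refine (bessel_enorm he _).trans ?_
      rw [← ofReal_norm, b.orthonormal.1]; simp
  have hmain : ∀ t, ‖⟪f t, A (e t)⟫_ℂ‖ₑ ≤ ∑' k, w t k * s k := by
    intro t
    have hsum : HasSum (fun k => ⟪f t, A (b k)⟫_ℂ * ⟪b k, e t⟫_ℂ) ⟪f t, A (e t)⟫_ℂ := by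
      have := ((innerSL ℂ (f t)).comp A).hasSum (b.hasSum_repr (e t))
      simpa [b.repr_apply_apply, inner_smul_right, mul_comm] using this
    rw [← hsum.tsum_eq]
    refine (enorm_tsum_le_tsum_enorm).trans ?_
    refine ENNReal.tsum_le_tsum fun k => ?_
    rw [hAb k, inner_smul_right, enorm_mul, enorm_mul]
    have hs : ‖((s k : ℝ) : ℂ)‖ₑ = s k := by
      rw [← ofReal_norm]; simp
    have hc : ‖⟪f t, u k⟫_ℂ‖ₑ = ‖⟪u k, f t⟫_ℂ‖ₑ := by
      rw [← inner_conj_symm, RCLike.enorm_conj]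
    rw [hs, hc, mul_assoc, mul_comm]
    gcongr
    simp only [w]
    have hreal : ∀ x y : ℝ, x * y ≤ 2⁻¹ * (x ^ 2 + y ^ 2) := fun x y => by
      nlinarith [sq_nonneg (x - y)]
    rw [← ofReal_norm, ← ofReal_norm, ← ENNReal.ofReal_mul (norm_nonneg _),
      ← ENNReal.ofReal_pow (norm_nonneg _), ← ENNReal.ofReal_pow (norm_nonneg _),
      ← ENNReal.ofReal_add (by positivity) (by positivity),
      show (2⁻¹ : ℝ≥0∞) = ENNReal.ofReal (2⁻¹) by
        rw [ENNReal.ofReal_inv_of_pos (by norm_num)]; simp,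
      ← ENNReal.ofReal_mul (by norm_num)]
    exact ENNReal.ofReal_le_ofReal (hreal _ _)
  calc ∑' t, ‖⟪f t, A (e t)⟫_ℂ‖ₑ ^ p ≤ ∑' t, (∑' k, w t k * s k) ^ p := by
        refine ENNReal.tsum_le_tsum fun t => ?_
        gcongr
        exact hmain t
    _ ≤ ∑' t, ∑' k, w t k * (s k : ℝ≥0∞) ^ p :=
        ENNReal.tsum_le_tsum fun t => ennreal_sum_wt_le hp _ _ (hw1 t)
    _ = ∑' k, (∑' t, w t k) * (s k : ℝ≥0∞) ^ p := by
        rw [ENNReal.tsum_comm]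
        simp_rw [ENNReal.tsum_mul_right]
    _ ≤ ∑' k, (s k : ℝ≥0∞) ^ p := by
        refine ENNReal.tsum_le_tsum fun k => ?_
        exact (mul_le_mul_left (hw2 k) _).trans (one_mul _).le

theorem SingularSystem.exists_attain {κ : Type*} {A : H →L[ℂ] H} {b : HilbertBasis κ ℂ H}
    {s : κ → ℝ≥0} (h : SingularSystem A b s) {p : ℝ} (hp : 0 < p) :
    ∃ e f : {k // s k ≠ 0} → H, Orthonormal ℂ e ∧ Orthonormal ℂ f ∧
      ∑' k, (s k : ℝ≥0∞) ^ p = ∑' t, ‖⟪f t, A (e t)⟫_ℂ‖ₑ ^ p := by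
  classical
  let u : κ → H := fun k => ((s k : ℝ)⁻¹ : ℂ) • A (b k)
  have hu : Orthonormal ℂ (fun k : {k // s k ≠ 0} => u k) := h.orthonormal_left
  refine ⟨fun k => b k, fun k => u k, b.orthonormal.comp _ Subtype.val_injective, hu, ?_⟩
  rw [← tsum_subtype_eq_of_support_subset (s := {k | s k ≠ 0})]
  · refine tsum_congr fun ⟨k, hk⟩ => ?_
    have hk' : ((s k : ℝ) : ℂ) ≠ 0 := by simpa using hk
    congr 1
    simp only [u, inner_smul_left, h.inner]
    rw [inner_self_eq_norm_sq_to_K, b.orthonormal.1 k]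
    have : ((starRingEnd ℂ) ((s k : ℝ)⁻¹ : ℂ)) * ((((s k : ℝ) ^ 2 : ℝ) : ℂ) * ((1 : ℝ) : ℂ) ^ 2)
        = ((s k : ℝ) : ℂ) := by
      simp only [map_inv₀, Complex.conj_ofReal]
      push_cast
      field_simp
    simp only [Complex.coe_algebraMap] at *
    erw [this]
    rw [← ofReal_norm]; simp
  · intro k hk hk0
    have hk1 : s k = 0 := by simpa using hk0
    simp [hk1, hp] at hk

end SchattenHelpers

section SchattenClasses

/-- The Hilbert space `ℓ²(I)` of square-summable complex families indexed by `I`. -/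
def Ell2 (I : Type*) : Type _ := lp (fun _ : I => ℂ) 2

noncomputable instance (I : Type*) : NormedAddCommGroup (Ell2 I) :=
  inferInstanceAs (NormedAddCommGroup (lp (fun _ : I => ℂ) 2))

noncomputable instance (I : Type*) : InnerProductSpace ℂ (Ell2 I) :=
  inferInstanceAs (InnerProductSpace ℂ (lp (fun _ : I => ℂ) 2))

instance (I : Type*) : CompleteSpace (Ell2 I) :=
  inferInstanceAs (CompleteSpace (lp (fun _ : I => ℂ) 2))

/-- The canonical orthonormal basis `(e_i)` of `ℓ²(I)` (the one with coordinate map the identity). -/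
noncomputable def stdBasis (I : Type*) : HilbertBasis I ℂ (Ell2 I) :=
  HilbertBasis.ofRepr (LinearIsometryEquiv.refl ℂ (Ell2 I))

/-- The matrix `[⟪e_i, A e_j⟫]` of a bounded operator `A` on `ℓ²(I)`. -/
noncomputable def opMatrix {I : Type*} (A : Ell2 I →L[ℂ] Ell2 I) : Matrix I I ℂ :=
  Matrix.of fun i j => ⟪stdBasis I i, A (stdBasis I j)⟫_ℂ

/-- The trace, in `[0, ∞]`, of a positive bounded operator on `ℓ²(I)`. -/
noncomputable def posTrace {I : Type*} (P : Ell2 I →L[ℂ] Ell2 I) : ℝ≥0∞ :=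
  ∑' i, ENNReal.ofReal (⟪stdBasis I i, P (stdBasis I i)⟫_ℂ).re

/-- The Schatten norm, with values in `[0, ∞]`: the operator norm for `p = ∞`, and
`(Tr (A† A) ^ (p / 2)) ^ (1 / p)` for finite `p`; `star A` is the adjoint of `A` and the power of the
positive operator `A† A` is given by the continuous functional calculus. -/
noncomputable def schattenENorm {I : Type*} (p : ℝ≥0∞) (A : Ell2 I →L[ℂ] Ell2 I) : ℝ≥0∞ :=
  open scoped Classical in
  if p = ∞ then ‖A‖ₑ else posTrace ((star A * A) ^ (p.toReal / 2)) ^ (1 / p.toReal)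

theorem one_le_toReal_of_fact {p : ℝ≥0∞} [hp : Fact (1 ≤ p)] (h : p ≠ ∞) : 1 ≤ p.toReal := by
  have := (ENNReal.toReal_le_toReal ENNReal.one_ne_top h).2 hp.out
  simpa using this

theorem schattenENorm_top {I : Type*} (A : Ell2 I →L[ℂ] Ell2 I) :
    schattenENorm ∞ A = ‖A‖ₑ := by simp [schattenENorm]

theorem schattenENorm_eq_of_singularSystem {I κ : Type*} {p : ℝ≥0∞} [Fact (1 ≤ p)] (h : p ≠ ∞)
    {A : Ell2 I →L[ℂ] Ell2 I} {b : HilbertBasis κ ℂ (Ell2 I)} {s : κ → ℝ≥0}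
    (hs : SingularSystem A b s) :
    schattenENorm p A = (∑' k, (s k : ℝ≥0∞) ^ p.toReal) ^ (1 / p.toReal) := by
  have hp := one_le_toReal_of_fact h
  rw [schattenENorm, if_neg h, posTrace, hs.trace_eq _ (by linarith)]

theorem tsum_inner_le_schattenENorm {I τ : Type*} {p : ℝ≥0∞} [Fact (1 ≤ p)] (h : p ≠ ∞)
    {A : Ell2 I →L[ℂ] Ell2 I} (hA : IsCompactOperator A) {e f : τ → Ell2 I}
    (he : Orthonormal ℂ e) (hf : Orthonormal ℂ f) :
    (∑' t, ‖⟪f t, A (e t)⟫_ℂ‖ₑ ^ p.toReal) ^ (1 / p.toReal) ≤ schattenENorm p A := by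
  obtain ⟨κ, b, s, hs⟩ := exists_singularSystem A hA
  have hp := one_le_toReal_of_fact h
  rw [schattenENorm_eq_of_singularSystem h hs]
  gcongr
  exact hs.tsum_le he hf hp

theorem enorm_inner_le_schattenENorm {I : Type*} {p : ℝ≥0∞} [Fact (1 ≤ p)]
    {A : Ell2 I →L[ℂ] Ell2 I} (hA : IsCompactOperator A) {e f : Ell2 I} (he : ‖e‖ = 1)
    (hf : ‖f‖ = 1) : ‖⟪f, A e⟫_ℂ‖ₑ ≤ schattenENorm p A := by
  by_cases h : p = ∞
  · subst h
    rw [schattenENorm_top, ← ofReal_norm, ← ofReal_norm]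
    refine ENNReal.ofReal_le_ofReal ((norm_inner_le_norm _ _).trans ?_)
    simpa [he, hf] using A.le_opNorm e
  · have hp := one_le_toReal_of_fact h
    have hon : ∀ x : Ell2 I, ‖x‖ = 1 → Orthonormal ℂ (fun _ : Unit => x) := fun x hx =>
      ⟨fun _ => hx, fun i j hij => (hij (Subsingleton.elim _ _)).elim⟩
    have := tsum_inner_le_schattenENorm h hA (hon e he) (hon f hf)
    rwa [tsum_fintype, Finset.univ_unique, Finset.sum_singleton, one_div,
      ENNReal.rpow_rpow_inv (by linarith)] at this

theorem schattenENorm_add_le {I : Type*} {p : ℝ≥0∞} [Fact (1 ≤ p)]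
    {A B : Ell2 I →L[ℂ] Ell2 I} (hA : IsCompactOperator A) (hB : IsCompactOperator B) :
    schattenENorm p (A + B) ≤ schattenENorm p A + schattenENorm p B := by
  by_cases h : p = ∞
  · subst h
    simpa only [schattenENorm_top] using enorm_add_le A B
  · have hp := one_le_toReal_of_fact h
    obtain ⟨κ, b, s, hs⟩ := exists_singularSystem (A + B) (hA.add hB)
    obtain ⟨e, f, he, hf, hef⟩ := hs.exists_attain (p := p.toReal) (by linarith)
    rw [schattenENorm_eq_of_singularSystem h hs, hef]
    calc _ ≤ (∑' t, (‖⟪f t, A (e t)⟫_ℂ‖ₑ + ‖⟪f t, B (e t)⟫_ℂ‖ₑ) ^ p.toReal) ^ (1 / p.toReal) := by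
          gcongr
          rw [add_apply, inner_add_right]
          exact enorm_add_le _ _
      _ ≤ _ := ennreal_tsum_add_le hp _ _
      _ ≤ _ := add_le_add (tsum_inner_le_schattenENorm h hA he hf)
          (tsum_inner_le_schattenENorm h hB he hf)

theorem schattenENorm_smul {I : Type*} {p : ℝ≥0∞} [Fact (1 ≤ p)] (c : ℂ)
    {A : Ell2 I →L[ℂ] Ell2 I} (hA : IsCompactOperator A) :
    schattenENorm p (c • A) = ‖c‖ₑ * schattenENorm p A := by
  by_cases h : p = ∞
  · subst h
    simpa only [schattenENorm_top] using enorm_smul c A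
  · have hp := one_le_toReal_of_fact h
    have hp0 : 0 < p.toReal := by linarith
    obtain ⟨κ, b, s, hs⟩ := exists_singularSystem A hA
    have hs' : SingularSystem (c • A) b (fun k => ‖c‖₊ * s k) := by
      intro k
      have : star (c • A) * (c • A) = ((‖c‖ ^ 2 : ℝ) : ℂ) • (star A * A) := by
        rw [star_smul, smul_mul_smul_comm]
        congr 1
        rw [← Complex.normSq_eq_norm_sq, Complex.normSq_eq_conj_mul_self]; rfl
      rw [this, smul_apply, hs k, smul_smul]
      congr 1
      push_cast
      ring
    rw [schattenENorm_eq_of_singularSystem h hs, schattenENorm_eq_of_singularSystem h hs']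
    simp_rw [ENNReal.coe_mul, ENNReal.mul_rpow_of_nonneg _ _ hp0.le]
    rw [ENNReal.tsum_mul_left, ENNReal.mul_rpow_of_nonneg _ _ (by positivity), one_div,
      ENNReal.rpow_rpow_inv hp0.ne']
    rfl

theorem schattenENorm_zero {I : Type*} {p : ℝ≥0∞} [Fact (1 ≤ p)] :
    schattenENorm p (0 : Ell2 I →L[ℂ] Ell2 I) = 0 := by
  have := schattenENorm_smul (p := p) 0 (A := (0 : Ell2 I →L[ℂ] Ell2 I)) isCompactOperator_zero
  simpa using this

theorem opMatrix_injective {I : Type*} {A B : Ell2 I →L[ℂ] Ell2 I} (h : opMatrix A = opMatrix B) :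
    A = B := by
  have h1 : ∀ j, A (stdBasis I j) = B (stdBasis I j) := by
    intro j
    apply (stdBasis I).repr.injective
    ext i
    rw [HilbertBasis.repr_apply_apply, HilbertBasis.repr_apply_apply]
    exact congrFun (congrFun h i) j
  refine ContinuousLinearMap.ext_on (s := Set.range (stdBasis I)) ?_ ?_
  · have := (stdBasis I).dense_span
    rwa [Submodule.dense_iff_topologicalClosure_eq_top]
  · rintro _ ⟨j, rfl⟩
    exact h1 j

/-- The compact operators on `ℓ²(I)` with finite Schatten norm. -/
def schattenSubmodule (I : Type*) (p : ℝ≥0∞) [Fact (1 ≤ p)] :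
    Submodule ℂ (Ell2 I →L[ℂ] Ell2 I) where
  carrier := {A | IsCompactOperator A ∧ schattenENorm p A < ∞}
  zero_mem' := ⟨isCompactOperator_zero, by rw [schattenENorm_zero]; exact ENNReal.zero_lt_top⟩
  add_mem' := fun hA hB => ⟨hA.1.add hB.1,
    (schattenENorm_add_le hA.1 hB.1).trans_lt (ENNReal.add_lt_top.2 ⟨hA.2, hB.2⟩)⟩
  smul_mem' := fun c A hA => ⟨hA.1.smul c, by
    rw [schattenENorm_smul c hA.1]; exact ENNReal.mul_lt_top (by simp) hA.2⟩

/-- The Schatten class `S_p^I`, with its own norm (not the operator norm). -/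
def SchattenClass (I : Type*) (p : ℝ≥0∞) [Fact (1 ≤ p)] : Type _ :=
  schattenSubmodule I p

namespace SchattenClass

variable {I : Type*} {p : ℝ≥0∞} [Fact (1 ≤ p)]

noncomputable instance : AddCommGroup (SchattenClass I p) :=
  inferInstanceAs (AddCommGroup (schattenSubmodule I p))

noncomputable instance : Module ℂ (SchattenClass I p) :=
  inferInstanceAs (Module ℂ (schattenSubmodule I p))

/-- The underlying operator. -/
noncomputable def toOp : SchattenClass I p →ₗ[ℂ] (Ell2 I →L[ℂ] Ell2 I) :=
  (schattenSubmodule I p).subtype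

theorem isCompactOperator (A : SchattenClass I p) : IsCompactOperator (toOp A) := A.2.1

theorem schattenENorm_lt_top (A : SchattenClass I p) : schattenENorm p (toOp A) < ∞ := A.2.2

noncomputable instance : Norm (SchattenClass I p) :=
  ⟨fun A => (schattenENorm p (toOp A)).toReal⟩

theorem norm_def (A : SchattenClass I p) : ‖A‖ = (schattenENorm p (toOp A)).toReal := rfl

theorem norm_smul_eq (c : ℂ) (A : SchattenClass I p) : ‖c • A‖ = ‖c‖ * ‖A‖ := by
  rw [norm_def, map_smul, schattenENorm_smul c A.isCompactOperator, ENNReal.toReal_mul,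
    toReal_enorm, norm_def]

/-- The matrix coefficient `a_ij`. -/
noncomputable def entryₗ (i j : I) : SchattenClass I p →ₗ[ℂ] ℂ where
  toFun A := opMatrix (toOp A) i j
  map_add' A B := by simp [opMatrix]
  map_smul' c A := by simp [opMatrix]

theorem norm_entryₗ_le (i j : I) (A : SchattenClass I p) : ‖entryₗ i j A‖ ≤ ‖A‖ := by
  have := enorm_inner_le_schattenENorm (p := p) A.isCompactOperator
    ((stdBasis I).orthonormal.1 j) ((stdBasis I).orthonormal.1 i)
  have h2 := ENNReal.toReal_mono A.schattenENorm_lt_top.ne this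
  rwa [toReal_enorm] at h2

noncomputable instance : NormedAddCommGroup (SchattenClass I p) :=
  AddGroupNorm.toNormedAddCommGroup
    { toFun := fun A => ‖A‖
      map_zero' := by simp [norm_def, schattenENorm_zero]
      add_le' := fun A B => by
        rw [norm_def, norm_def, norm_def, ← ENNReal.toReal_add A.schattenENorm_lt_top.ne
          B.schattenENorm_lt_top.ne, map_add]
        exact ENNReal.toReal_mono (ENNReal.add_lt_top.2 ⟨A.schattenENorm_lt_top,
          B.schattenENorm_lt_top⟩).ne (schattenENorm_add_le A.isCompactOperator B.isCompactOperator)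
      neg' := fun A => by simpa using norm_smul_eq (-1) A
      eq_zero_of_map_eq_zero' := fun A hA => by
        apply Subtype.val_injective
        refine opMatrix_injective (I := I) ?_
        ext i j
        have := norm_entryₗ_le i j A
        rw [hA] at this
        have h0 : entryₗ i j A = 0 := norm_le_zero_iff.1 this
        exact h0.trans (entryₗ (p := p) i j).map_zero.symm }

noncomputable instance : NormedSpace ℂ (SchattenClass I p) where
  norm_smul_le c A := (norm_smul_eq c A).le

/-- The matrix `[a_ij]` of an element of the Schatten class. -/
noncomputable def toMatrix (A : SchattenClass I p) : Matrix I I ℂ := opMatrix (toOp A)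

/-- The matrix coefficient `a_ij`, as a bounded linear functional. -/
noncomputable def entry (i j : I) : SchattenClass I p →L[ℂ] ℂ :=
  (entryₗ i j).mkContinuous 1 fun A => by simpa using norm_entryₗ_le i j A

theorem entry_apply (i j : I) (A : SchattenClass I p) : entry i j A = A.toMatrix i j := rfl

end SchattenClass

end SchattenClasses

section SchurPredual

open scoped TensorProduct

/-- The pair of exponents `(p, p*)`, where `1 / p + 1 / p* = 1`. -/
noncomputable def dualPair (p : ℝ≥0∞) : Fin 2 → ℝ≥0∞ := ![p, p.conjExponent]

instance dualPair_fact (p : ℝ≥0∞) [hp : Fact (1 ≤ p)] (k : Fin 2) : Fact (1 ≤ dualPair p k) := by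
  refine ⟨?_⟩
  fin_cases k
  · exact hp.out
  · exact le_self_add

/-- The Banach space projective tensor product `S_p^I ⊗_γ S_{p*}^I`: the completion of the algebraic
tensor product (of the family of the two spaces `S_p^I`, `S_{p*}^I`) for the projective norm, which
is the norm that Mathlib puts on this tensor product. -/
abbrev SchattenProjTensor (I : Type*) (p : ℝ≥0∞) [Fact (1 ≤ p)] : Type _ :=
  UniformSpace.Completion (⨂[ℂ] k : Fin 2, SchattenClass I (dualPair p k))

/-- The bounded functional on the algebraic tensor product with `A ⊗ B ↦ a_ij b_ij`. -/
noncomputable def schurEntry (I : Type*) (p : ℝ≥0∞) [Fact (1 ≤ p)] (i j : I) :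
    (⨂[ℂ] k : Fin 2, SchattenClass I (dualPair p k)) →L[ℂ] ℂ :=
  PiTensorProduct.liftIsometry ℂ (fun k : Fin 2 => SchattenClass I (dualPair p k)) ℂ
    ((ContinuousMultilinearMap.mkPiAlgebra ℂ (Fin 2) ℂ).compContinuousLinearMap
      fun k => (SchattenClass.entry i j : SchattenClass I (dualPair p k) →L[ℂ] ℂ))

/-- The map `φ_p^I` with `A ⊗ B ↦ A * B` (Schur product), extended by continuity, coefficient by
coefficient, to the projective tensor product. Its values are written as matrices. -/
noncomputable def schurMap (I : Type*) (p : ℝ≥0∞) [Fact (1 ≤ p)] :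
    SchattenProjTensor I p →ₗ[ℂ] Matrix I I ℂ where
  toFun u := Matrix.of fun i j =>
    (schurEntry I p i j).extend (UniformSpace.Completion.toComplL (𝕜 := ℂ)) u
  map_add' u v := by ext i j; simp
  map_smul' c u := by ext i j; simp

theorem schurMap_coe (I : Type*) (p : ℝ≥0∞) [Fact (1 ≤ p)]
    (x : ⨂[ℂ] k : Fin 2, SchattenClass I (dualPair p k)) (i j : I) :
    schurMap I p (x : SchattenProjTensor I p) i j = schurEntry I p i j x := by
  refine ContinuousLinearMap.extend_eq (e := UniformSpace.Completion.toComplL (𝕜 := ℂ)) _ ?_ ?_ x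
  · exact UniformSpace.Completion.denseRange_coe
  · exact UniformSpace.Completion.isUniformInducing_coe _

open scoped Matrix in
/-- On elementary tensors, `φ_p^I` is the Schur product. -/
theorem schurMap_tprod (I : Type*) (p : ℝ≥0∞) [Fact (1 ≤ p)]
    (m : ∀ k : Fin 2, SchattenClass I (dualPair p k)) :
    schurMap I p ((PiTensorProduct.tprod ℂ m :
      ⨂[ℂ] k : Fin 2, SchattenClass I (dualPair p k)) : SchattenProjTensor I p) =
      (m 0).toMatrix ⊙ (m 1).toMatrix := by
  ext i j
  rw [schurMap_coe]
  simp [schurEntry, Fin.prod_univ_two, SchattenClass.entry_apply]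

instance isClosed_ker_schurMap (I : Type*) (p : ℝ≥0∞) [Fact (1 ≤ p)] :
    IsClosed (LinearMap.ker (schurMap I p) : Set (SchattenProjTensor I p)) := by
  have : (LinearMap.ker (schurMap I p) : Set (SchattenProjTensor I p)) = ⋂ i, ⋂ j,
      {u | (schurEntry I p i j).extend (UniformSpace.Completion.toComplL (𝕜 := ℂ)) u = 0} := by
    ext u
    simp only [SetLike.mem_coe, LinearMap.mem_ker, Set.mem_iInter, Set.mem_ofPred_eq]
    exact ⟨fun h i j => congrFun (congrFun h i) j, fun h => by ext i j; exact h i j⟩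
  rw [this]
  exact isClosed_iInter fun i => isClosed_iInter fun j =>
    isClosed_eq (ContinuousLinearMap.continuous _) continuous_const

/-- The space `R_p^I`: the image of `φ_p^I`, a space of matrices. -/
def SchurPredual (I : Type*) (p : ℝ≥0∞) [Fact (1 ≤ p)] : Type _ :=
  LinearMap.range (schurMap I p)

namespace SchurPredual

variable {I : Type*} {p : ℝ≥0∞} [Fact (1 ≤ p)]

noncomputable instance : AddCommGroup (SchurPredual I p) :=
  inferInstanceAs (AddCommGroup (LinearMap.range (schurMap I p)))

noncomputable instance : Module ℂ (SchurPredual I p) :=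
  inferInstanceAs (Module ℂ (LinearMap.range (schurMap I p)))

/-- The matrix underlying an element of `R_p^I`. -/
noncomputable def toMatrix : SchurPredual I p →ₗ[ℂ] Matrix I I ℂ :=
  (LinearMap.range (schurMap I p)).subtype

/-- The canonical linear isomorphism of `R_p^I = Im φ_p^I` onto the quotient of the projective
tensor product by `Ker φ_p^I`. -/
noncomputable def equivQuotient (I : Type*) (p : ℝ≥0∞) [Fact (1 ≤ p)] :
    SchurPredual I p ≃ₗ[ℂ] SchattenProjTensor I p ⧸ LinearMap.ker (schurMap I p) :=
  (schurMap I p).quotKerEquivRange.symm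

/-- The norm of `R_p^I` is the quotient norm, transported by the canonical isomorphism. -/
noncomputable instance : NormedAddCommGroup (SchurPredual I p) :=
  NormedAddCommGroup.induced (SchurPredual I p)
    (SchattenProjTensor I p ⧸ LinearMap.ker (schurMap I p)) (equivQuotient I p).toLinearMap
    (equivQuotient I p).injective

noncomputable instance : NormedSpace ℂ (SchurPredual I p) :=
  NormedSpace.induced ℂ (SchurPredual I p)
    (SchattenProjTensor I p ⧸ LinearMap.ker (schurMap I p)) (equivQuotient I p).toLinearMap

end SchurPredual

/-- The normed space `E`, with the product `mul`, is a commutative complex Banach algebra (not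
necessarily unital): it is complete, `mul` is bilinear, associative and commutative, and the norm is
submultiplicative. -/
structure IsCommBanachAlgebra (E : Type*) [NormedAddCommGroup E] [NormedSpace ℂ E]
    (mul : E → E → E) : Prop where
  complete : CompleteSpace E
  add_mul : ∀ a b c, mul (a + b) c = mul a c + mul b c
  mul_add : ∀ a b c, mul a (b + c) = mul a b + mul a c
  smul_mul : ∀ (z : ℂ) a b, mul (z • a) b = z • mul a b
  mul_smul : ∀ (z : ℂ) a b, mul a (z • b) = z • mul a b
  mul_assoc : ∀ a b c, mul (mul a b) c = mul a (mul b c)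
  mul_comm : ∀ a b, mul a b = mul b a
  norm_mul_le : ∀ a b, ‖mul a b‖ ≤ ‖a‖ * ‖b‖

end SchurPredual

/-! ### Schur products of bounded operators -/

section SchurOperator

/-! Everything rests on the inequality ‖A * C‖ ≤ ‖A‖ ‖C‖ in each Schatten norm
(`schattenENorm_schurOp_le`). Conceptually, A * C is the compression of A ⊗ C to the diagonal
vectors e_i ⊗ e_i, and the singular values of A ⊗ C are the products s_k r_l.

For finite exponents this is carried out without forming A ⊗ C. From A = ∑ s_k u_k ⟪b_k, ·⟫ and C =
∑ r_l v_l ⟪d_l, ·⟫ one gets A * C = ∑ s_k r_l (u_k v_l) ⟪b_k d_l, ·⟫, with coordinatewise products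
of vectors. The families (u_k v_l) and (b_k d_l) satisfy Bessel's inequality
(`tsum_inner_truncMul_le`) and consist of vectors of norm at most 1. Hence, for orthonormal families
e and f, |⟪f_t, (A * C) e_t⟫| is bounded by averages of the s_k r_l with doubly substochastic
weights, and convexity of x ↦ x ^ p concludes (`tsum_inner_coordProj_schurOp_le`). The operator norm
is handled by Cauchy-Schwarz (`norm_schurOp_le`), and compactness by approximation with finitely
many rows (`isCompactOperator_schurOp`).

The rule (A ⊗ B)(C ⊗ D) = (A * C) ⊗ (B * D) then defines a contractive product for the projective
norm (`norm_tensorSchurL_apply_le`), which extends to the completion. Since φ turns it into the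
Schur product (`exists_schurMap_eq_hadamard`), the image of φ is closed under Schur products and the
quotient norm is submultiplicative. The algebraic laws hold entry by entry. -/

theorem ennreal_tsum_mul_sq_le {κ : Type*} (f g : κ → ℝ≥0∞) :
    (∑' k, f k * g k) ^ 2 ≤ (∑' k, f k ^ 2) * ∑' k, g k ^ 2 := by
  have key : ∑' k, f k * g k ≤
      (∑' k, f k ^ 2) ^ (1 / 2 : ℝ) * (∑' k, g k ^ 2) ^ (1 / 2 : ℝ) := by
    rw [ENNReal.tsum_eq_iSup_sum]
    refine iSup_le fun s => ?_
    refine (ENNReal.inner_le_Lp_mul_Lq s f g Real.HolderConjugate.two_two).trans ?_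
    simp only [ENNReal.rpow_two]
    gcongr <;> exact ENNReal.sum_le_tsum s
  calc _ ≤ ((∑' k, f k ^ 2) ^ (1 / 2 : ℝ) * (∑' k, g k ^ 2) ^ (1 / 2 : ℝ)) ^ 2 := by gcongr
    _ = _ := by
      rw [mul_pow, ← ENNReal.rpow_natCast, ← ENNReal.rpow_natCast, ← ENNReal.rpow_mul,
        ← ENNReal.rpow_mul]
      norm_num

variable {I : Type*}

theorem enorm_opMatrix_eq_adjoint (A : Ell2 I →L[ℂ] Ell2 I) (i j : I) :
    ‖opMatrix A i j‖ₑ = ‖⟪stdBasis I j, star A (stdBasis I i)⟫_ℂ‖ₑ := by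
  rw [opMatrix, Matrix.of_apply, ContinuousLinearMap.star_eq_adjoint,
    ContinuousLinearMap.adjoint_inner_right, ← inner_conj_symm, RCLike.enorm_conj]

theorem enorm_apply_stdBasis_le (A : Ell2 I →L[ℂ] Ell2 I) (j : I) :
    ‖A (stdBasis I j)‖ₑ ≤ ‖A‖ₑ := by
  have := A.le_opNorm (stdBasis I j)
  rw [(stdBasis I).orthonormal.1 j, mul_one] at this
  rw [← ofReal_norm, ← ofReal_norm]
  exact ENNReal.ofReal_le_ofReal this

theorem tsum_enorm_opMatrix_col_le (A : Ell2 I →L[ℂ] Ell2 I) (j : I) :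
    ∑' i, ‖opMatrix A i j‖ₑ ^ 2 ≤ ‖A‖ₑ ^ 2 := by
  have := parseval_enorm (stdBasis I) (A (stdBasis I j))
  refine this.le.trans ?_
  gcongr
  exact enorm_apply_stdBasis_le A j

theorem tsum_enorm_opMatrix_row_le (A : Ell2 I →L[ℂ] Ell2 I) (i : I) :
    ∑' j, ‖opMatrix A i j‖ₑ ^ 2 ≤ ‖A‖ₑ ^ 2 := by
  simp_rw [enorm_opMatrix_eq_adjoint]
  rw [parseval_enorm]
  gcongr
  refine (enorm_apply_stdBasis_le _ i).trans ?_
  rw [← ofReal_norm, ← ofReal_norm, norm_star]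

/-- Cauchy-Schwarz in j, with |a_ij| |x_j| as one factor and |c_ij| as the other. The rows of C are
then bounded in ℓ², which leaves the columns of A for the summation over i. -/
theorem tsum_enorm_schurRow_sq_le (A C : Ell2 I →L[ℂ] Ell2 I) (x : Ell2 I) (i : I) :
    (∑' j, ‖opMatrix A i j * opMatrix C i j * ⟪stdBasis I j, x⟫_ℂ‖ₑ) ^ 2 ≤
      (∑' j, ‖opMatrix A i j‖ₑ ^ 2 * ‖⟪stdBasis I j, x⟫_ℂ‖ₑ ^ 2) * ‖C‖ₑ ^ 2 := by
  calc _ = (∑' j, (‖opMatrix A i j‖ₑ * ‖⟪stdBasis I j, x⟫_ℂ‖ₑ) * ‖opMatrix C i j‖ₑ) ^ 2 := by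
        congr 1
        refine tsum_congr fun j => ?_
        rw [enorm_mul, enorm_mul]; ring
    _ ≤ _ := ennreal_tsum_mul_sq_le _ _
    _ ≤ _ := by
        simp_rw [mul_pow]
        gcongr
        exact tsum_enorm_opMatrix_row_le C i

theorem tsum_tsum_enorm_schurRow_sq_le (A C : Ell2 I →L[ℂ] Ell2 I) (x : Ell2 I) :
    ∑' i, (∑' j, ‖opMatrix A i j * opMatrix C i j * ⟪stdBasis I j, x⟫_ℂ‖ₑ) ^ 2 ≤
      (‖A‖ₑ * ‖C‖ₑ * ‖x‖ₑ) ^ 2 := by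
  calc _ ≤ ∑' i, (∑' j, ‖opMatrix A i j‖ₑ ^ 2 * ‖⟪stdBasis I j, x⟫_ℂ‖ₑ ^ 2) * ‖C‖ₑ ^ 2 :=
        ENNReal.tsum_le_tsum fun i => tsum_enorm_schurRow_sq_le A C x i
    -- Exchanging the sums exposes the columns of A, bounded in ℓ² uniformly in j.
    _ = (∑' j, (∑' i, ‖opMatrix A i j‖ₑ ^ 2) * ‖⟪stdBasis I j, x⟫_ℂ‖ₑ ^ 2) * ‖C‖ₑ ^ 2 := by
        rw [ENNReal.tsum_mul_right, ENNReal.tsum_comm]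
        simp_rw [ENNReal.tsum_mul_right]
    _ ≤ (∑' j, ‖A‖ₑ ^ 2 * ‖⟪stdBasis I j, x⟫_ℂ‖ₑ ^ 2) * ‖C‖ₑ ^ 2 := by
        gcongr with j
        exact tsum_enorm_opMatrix_col_le A j
    _ = _ := by
        rw [ENNReal.tsum_mul_left, parseval_enorm]; ring

theorem summable_schurRow (A C : Ell2 I →L[ℂ] Ell2 I) (x : Ell2 I) (i : I) :
    Summable fun j => opMatrix A i j * opMatrix C i j * ⟪stdBasis I j, x⟫_ℂ := by
  refine Summable.of_enorm fun h => ?_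
  have := (ENNReal.le_tsum i).trans (tsum_tsum_enorm_schurRow_sq_le A C x)
  rw [h, ENNReal.top_pow (by norm_num), top_le_iff] at this
  exact ENNReal.pow_ne_top (ENNReal.mul_ne_top (ENNReal.mul_ne_top (by simp) (by simp))
    (by simp)) this

theorem tsum_enorm_schurRow_tsum_sq_le (A C : Ell2 I →L[ℂ] Ell2 I) (x : Ell2 I) :
    ∑' i, ‖∑' j, opMatrix A i j * opMatrix C i j * ⟪stdBasis I j, x⟫_ℂ‖ₑ ^ 2 ≤
      (‖A‖ₑ * ‖C‖ₑ * ‖x‖ₑ) ^ 2 := by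
  refine le_trans (ENNReal.tsum_le_tsum fun i => ?_) (tsum_tsum_enorm_schurRow_sq_le A C x)
  gcongr
  exact enorm_tsum_le_tsum_enorm

theorem memℓp_schurRow (A C : Ell2 I →L[ℂ] Ell2 I) (x : Ell2 I) :
    Memℓp (fun i => ∑' j, opMatrix A i j * opMatrix C i j * ⟪stdBasis I j, x⟫_ℂ) 2 := by
  refine memℓp_gen ?_
  refine Summable.of_enorm fun h => ?_
  have := tsum_enorm_schurRow_tsum_sq_le A C x
  have h2 : ∀ z : ℂ, ‖‖z‖ ^ (2 : ℝ≥0∞).toReal‖ₑ = ‖z‖ₑ ^ 2 := by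
    intro z
    simp
  simp_rw [h2] at h
  rw [h, top_le_iff] at this
  exact ENNReal.pow_ne_top (ENNReal.mul_ne_top (ENNReal.mul_ne_top (by simp) (by simp))
    (by simp)) this

/-- The action of the Schur product of the matrices of two bounded operators. -/
noncomputable def schurOpₗ (A C : Ell2 I →L[ℂ] Ell2 I) : Ell2 I →ₗ[ℂ] Ell2 I where
  toFun x := (⟨_, memℓp_schurRow A C x⟩ : lp (fun _ : I => ℂ) 2)
  map_add' x y := by
    apply Subtype.ext
    funext i
    change ∑' j, opMatrix A i j * opMatrix C i j * ⟪stdBasis I j, x + y⟫_ℂ =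
      ∑' j, opMatrix A i j * opMatrix C i j * ⟪stdBasis I j, x⟫_ℂ +
        ∑' j, opMatrix A i j * opMatrix C i j * ⟪stdBasis I j, y⟫_ℂ
    rw [← (summable_schurRow A C x i).tsum_add (summable_schurRow A C y i)]
    simp_rw [inner_add_right, mul_add]
  map_smul' c x := by
    apply Subtype.ext
    funext i
    change ∑' j, opMatrix A i j * opMatrix C i j * ⟪stdBasis I j, c • x⟫_ℂ =
      c * ∑' j, opMatrix A i j * opMatrix C i j * ⟪stdBasis I j, x⟫_ℂ
    rw [← tsum_mul_left]
    refine tsum_congr fun j => ?_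
    rw [inner_smul_right]; ring

theorem inner_stdBasis_schurOpₗ (A C : Ell2 I →L[ℂ] Ell2 I) (x : Ell2 I) (i : I) :
    ⟪stdBasis I i, schurOpₗ A C x⟫_ℂ =
      ∑' j, opMatrix A i j * opMatrix C i j * ⟪stdBasis I j, x⟫_ℂ := by
  rw [← HilbertBasis.repr_apply_apply]
  rfl

theorem norm_schurOpₗ_le (A C : Ell2 I →L[ℂ] Ell2 I) (x : Ell2 I) :
    ‖schurOpₗ A C x‖ ≤ ‖A‖ * ‖C‖ * ‖x‖ := by
  have h := tsum_enorm_schurRow_tsum_sq_le A C x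
  simp_rw [← inner_stdBasis_schurOpₗ] at h
  rw [parseval_enorm, ENNReal.pow_le_pow_left_iff (by norm_num)] at h
  have := ENNReal.toReal_mono (ENNReal.mul_ne_top (ENNReal.mul_ne_top (by simp) (by simp))
    (by simp)) h
  simpa using this

/-- The bounded operator whose matrix is the Schur product of those of two bounded operators. -/
noncomputable def schurOp (A C : Ell2 I →L[ℂ] Ell2 I) : Ell2 I →L[ℂ] Ell2 I :=
  (schurOpₗ A C).mkContinuous (‖A‖ * ‖C‖) (norm_schurOpₗ_le A C)

theorem norm_schurOp_le (A C : Ell2 I →L[ℂ] Ell2 I) : ‖schurOp A C‖ ≤ ‖A‖ * ‖C‖ :=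
  LinearMap.mkContinuous_norm_le _ (by positivity) _

theorem opMatrix_schurOp (A C : Ell2 I →L[ℂ] Ell2 I) :
    opMatrix (schurOp A C) = opMatrix A ⊙ opMatrix C := by
  classical
  ext i j
  rw [opMatrix, Matrix.of_apply]
  change ⟪stdBasis I i, schurOpₗ A C (stdBasis I j)⟫_ℂ = _
  rw [inner_stdBasis_schurOpₗ, tsum_eq_single j]
  · rw [inner_self_eq_norm_sq_to_K, (stdBasis I).orthonormal.1 j]
    simp
  · intro k hk
    rw [(stdBasis I).orthonormal.2 hk, mul_zero]

/-! ### Coordinate truncations and compactness of Schur products -/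

/-- Coordinate truncation to a finite set of indices. -/
noncomputable def coordProj (F : Finset I) : Ell2 I →L[ℂ] Ell2 I :=
  ∑ i ∈ F, (innerSL ℂ (stdBasis I i)).smulRight (stdBasis I i)

theorem coordProj_apply (F : Finset I) (x : Ell2 I) :
    coordProj F x = ∑ i ∈ F, ⟪stdBasis I i, x⟫_ℂ • stdBasis I i := by
  simp [coordProj]

theorem inner_stdBasis_sum (F : Finset I) (c : I → ℂ) (i : I) [Decidable (i ∈ F)] :
    ⟪stdBasis I i, ∑ j ∈ F, c j • stdBasis I j⟫_ℂ = if i ∈ F then c i else 0 := by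
  classical
  rw [inner_sum]
  simp_rw [inner_smul_right, orthonormal_iff_ite.1 (stdBasis I).orthonormal]
  simp

theorem enorm_sum_smul_stdBasis_sq (F : Finset I) (c : I → ℂ) :
    ‖∑ j ∈ F, c j • stdBasis I j‖ₑ ^ 2 = ∑ j ∈ F, ‖c j‖ₑ ^ 2 := by
  classical
  rw [← parseval_enorm (stdBasis I), tsum_eq_sum (s := F)]
  · refine Finset.sum_congr rfl fun i hi => ?_
    rw [inner_stdBasis_sum, if_pos hi]
  · intro i hi
    rw [inner_stdBasis_sum, if_neg hi]; simp

theorem norm_coordProj_apply_le (F : Finset I) (x : Ell2 I) : ‖coordProj F x‖ ≤ ‖x‖ := by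
  have h : ‖coordProj F x‖ₑ ^ 2 ≤ ‖x‖ₑ ^ 2 := by
    rw [coordProj_apply, enorm_sum_smul_stdBasis_sq, ← parseval_enorm (stdBasis I) x]
    exact ENNReal.sum_le_tsum F
  rw [ENNReal.pow_le_pow_left_iff (by norm_num)] at h
  simpa using ENNReal.toReal_mono (by simp) h

theorem tendsto_coordProj_apply (x : Ell2 I) :
    Filter.Tendsto (fun F => coordProj F x) Filter.atTop (nhds x) := by
  have := (stdBasis I).hasSum_repr x
  simp only [HilbertBasis.repr_apply_apply] at this
  simp_rw [coordProj_apply]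
  exact this

theorem isCompactOperator_coordProj (F : Finset I) : IsCompactOperator (coordProj F) := by
  have h1 : ∀ i, IsCompactOperator
      ((innerSL ℂ (stdBasis I i)).smulRight (stdBasis I i) : Ell2 I →L[ℂ] Ell2 I) := by
    intro i
    have : IsCompactOperator (innerSL ℂ (stdBasis I i) : Ell2 I →L[ℂ] ℂ) :=
      isCompactOperator_of_locallyCompactSpace_dom _
    exact this.clm_comp (ContinuousLinearMap.toSpanSingleton ℂ (stdBasis I i))
  exact (compactOperator (RingHom.id ℂ) (Ell2 I) (Ell2 I)).sum_mem fun i _ => h1 i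

/-- The truncations are contractions converging pointwise to the identity, so they converge
uniformly on relatively compact sets, in particular on the image of the unit ball under A. -/
theorem tendsto_coordProj_comp {A : Ell2 I →L[ℂ] Ell2 I} (hA : IsCompactOperator A) :
    Filter.Tendsto (fun F => coordProj F ∘L A) Filter.atTop (nhds A) := by
  rw [Metric.tendsto_nhds]
  intro ε hε
  have hK := hA.isCompact_closure_image_closedBall (f := (A : Ell2 I →ₗ[ℂ] Ell2 I)) 1
  obtain ⟨t, -, ht, hcov⟩ := hK.finite_cover_balls (e := ε / 4) (by positivity)
  have hev : ∀ᶠ F in Filter.atTop, ∀ y ∈ t, dist (coordProj F y) y < ε / 4 :=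
    (Filter.eventually_all_finite ht).2 fun y _ =>
      Metric.tendsto_nhds.1 (tendsto_coordProj_apply y) _ (by positivity)
  filter_upwards [hev] with F hF
  rw [dist_eq_norm]
  -- Three errors below ε/4 each: the truncated A x - y, the truncation error at the net point y,
  -- and y - A x. The total 3ε/4 leaves the strict inequality.
  refine lt_of_le_of_lt (ContinuousLinearMap.opNorm_le_of_unit_norm
    (C := 3 * (ε / 4)) (by positivity) fun x hx => ?_) (by linarith)
  have hx' : A x ∈ closure ((A : Ell2 I →ₗ[ℂ] Ell2 I) '' Metric.closedBall 0 1) :=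
    subset_closure ⟨x, by simp [hx], rfl⟩
  obtain ⟨y, hy, hxy⟩ := Set.mem_iUnion₂.1 (hcov hx')
  rw [Metric.mem_ball, dist_eq_norm] at hxy
  have h1 := hF y hy
  rw [dist_eq_norm] at h1
  have h2 := norm_coordProj_apply_le F (A x - y)
  have h3 : (coordProj F ∘L A - A) x =
      coordProj F (A x - y) + (coordProj F y - y) + (y - A x) := by
    simp
  rw [h3]
  refine (norm_add₃_le).trans ?_
  rw [norm_sub_rev y]
  linarith

theorem opMatrix_sub (A B : Ell2 I →L[ℂ] Ell2 I) : opMatrix (A - B) = opMatrix A - opMatrix B := by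
  ext i j; simp [opMatrix]

theorem schurOp_sub_left (A B C : Ell2 I →L[ℂ] Ell2 I) :
    schurOp (A - B) C = schurOp A C - schurOp B C := by
  apply opMatrix_injective
  simp only [opMatrix_schurOp, opMatrix_sub]
  ext i j; simp [sub_mul]

theorem opMatrix_coordProj_comp (F : Finset I) (A : Ell2 I →L[ℂ] Ell2 I) (i j : I)
    [Decidable (i ∈ F)] :
    opMatrix (coordProj F ∘L A) i j = if i ∈ F then opMatrix A i j else 0 := by
  rw [opMatrix, Matrix.of_apply, ContinuousLinearMap.comp_apply, coordProj_apply,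
    inner_stdBasis_sum]
  rfl

/-- Truncating on the left only deletes the rows outside F, and deleting rows commutes with
entrywise products. -/
theorem schurOp_coordProj_comp (F : Finset I) (A C : Ell2 I →L[ℂ] Ell2 I) :
    schurOp (coordProj F ∘L A) C = coordProj F ∘L schurOp A C := by
  classical
  apply opMatrix_injective
  ext i j
  simp [opMatrix_schurOp, opMatrix_coordProj_comp]

/-- The finite-rank truncations of A * C are the Schur products with C of the truncations of A.
These converge in operator norm because Schur multiplication by C is bounded, so compactness of A
alone suffices. -/
theorem isCompactOperator_schurOp {A : Ell2 I →L[ℂ] Ell2 I} (hA : IsCompactOperator A)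
    (C : Ell2 I →L[ℂ] Ell2 I) : IsCompactOperator (schurOp A C) := by
  refine isCompactOperator_of_tendsto (l := Filter.atTop)
    (F := fun F : Finset I => coordProj F ∘L schurOp A C) ?_
    (Filter.Eventually.of_forall fun F => (isCompactOperator_coordProj F).comp_clm _)
  rw [tendsto_iff_norm_sub_tendsto_zero]
  have h := (tendsto_iff_norm_sub_tendsto_zero.1 (tendsto_coordProj_comp hA)).mul_const ‖C‖
  rw [zero_mul] at h
  refine squeeze_zero (fun _ => norm_nonneg _) (fun F => ?_) h
  rw [← schurOp_coordProj_comp, ← schurOp_sub_left]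
  exact norm_schurOp_le _ _

end SchurOperator

/-! ### Submultiplicativity of the Schatten norms under Schur products -/

section SchurSchatten

/-- The left singular vectors are s_k⁻¹ A b_k, which is 0 when s_k = 0. Keeping these zeros allows
the same index set as for b, at the price of having Bessel's inequality in place of orthonormality.
-/
theorem SingularSystem.exists_left {H κ : Type*} [NormedAddCommGroup H] [InnerProductSpace ℂ H]
    [CompleteSpace H] {A : H →L[ℂ] H} {b : HilbertBasis κ ℂ H} {s : κ → ℝ≥0}
    (h : SingularSystem A b s) :
    ∃ u : κ → H, (∀ k, A (b k) = ((s k : ℝ) : ℂ) • u k) ∧ (∀ k, ‖u k‖ₑ ≤ 1) ∧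
      ∀ x : H, ∑' k, ‖⟪u k, x⟫_ℂ‖ₑ ^ 2 ≤ ‖x‖ₑ ^ 2 := by
  let u : κ → H := fun k => ((s k : ℝ)⁻¹ : ℂ) • A (b k)
  have hu : Orthonormal ℂ (fun k : {k // s k ≠ 0} => u k) := h.orthonormal_left
  have hu0 : ∀ k, s k = 0 → u k = 0 := by
    intro k hk; simp [u, hk]
  refine ⟨u, fun k => ?_, fun k => ?_, fun x => ?_⟩
  · by_cases hk : s k = 0
    -- Here ‖A b_k‖² = s_k² = 0, so both sides vanish.
    · have := h.inner k k
      rw [hk] at this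
      simpa [hk] using this
    · have : ((s k : ℝ) : ℂ) ≠ 0 := by simpa using hk
      simp only [u]
      rw [smul_smul, mul_inv_cancel₀ this, one_smul]
  · by_cases hk : s k = 0
    · simp [hu0 k hk]
    · have := hu.1 ⟨k, hk⟩
      simp only at this
      rw [← ofReal_norm, this]; simp
  · refine le_trans (le_of_eq ?_) (bessel_enorm hu x)
    refine (tsum_subtype_eq_of_support_subset (s := {k | s k ≠ 0})
      (f := fun k => ‖⟪u k, x⟫_ℂ‖ₑ ^ 2) ?_).symm
    intro k hk hk0
    apply hk
    simp [hu0 k (by simpa using hk0)]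

variable {I : Type*}

theorem enorm_inner_symm {H : Type*} [NormedAddCommGroup H] [InnerProductSpace ℂ H] (x y : H) :
    ‖⟪x, y⟫_ℂ‖ₑ = ‖⟪y, x⟫_ℂ‖ₑ := by
  rw [← inner_conj_symm, RCLike.enorm_conj]

theorem enorm_inner_stdBasis_le_one {u : Ell2 I} (hu : ‖u‖ₑ ≤ 1) (i : I) :
    ‖⟪stdBasis I i, u⟫_ℂ‖ₑ ≤ 1 := by
  have h := (ENNReal.le_tsum i).trans (parseval_enorm (stdBasis I) u).le
  rw [ENNReal.pow_le_pow_left_iff (by norm_num)] at h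
  exact h.trans hu

/-- The singular value decomposition read off entrywise: expand e_j in the basis b and apply A term
by term. -/
theorem hasSum_opMatrix {κ : Type*} {A : Ell2 I →L[ℂ] Ell2 I} {b : HilbertBasis κ ℂ (Ell2 I)}
    {s : κ → ℝ≥0} {u : κ → Ell2 I} (hu : ∀ k, A (b k) = ((s k : ℝ) : ℂ) • u k) (i j : I) :
    HasSum (fun k => ((s k : ℝ) : ℂ) * (⟪stdBasis I i, u k⟫_ℂ * ⟪b k, stdBasis I j⟫_ℂ))
      (opMatrix A i j) := by
  have := ((innerSL ℂ (stdBasis I i)).comp A).hasSum (b.hasSum_repr (stdBasis I j))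
  refine (this.congr_fun fun k => ?_)
  simp [b.repr_apply_apply, hu k]
  ring

/-- The coordinatewise product of two vectors, truncated to a finite set of indices. -/
noncomputable def truncMul (F : Finset I) (u v : Ell2 I) : Ell2 I :=
  ∑ i ∈ F, (⟪stdBasis I i, u⟫_ℂ * ⟪stdBasis I i, v⟫_ℂ) • stdBasis I i

theorem inner_truncMul (F : Finset I) (x u v : Ell2 I) :
    ⟪x, truncMul F u v⟫_ℂ =
      ∑ i ∈ F, ⟪x, stdBasis I i⟫_ℂ * (⟪stdBasis I i, u⟫_ℂ * ⟪stdBasis I i, v⟫_ℂ) := by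
  rw [truncMul, inner_sum]
  exact Finset.sum_congr rfl fun i _ => by rw [inner_smul_right, mul_comm]

theorem truncMul_inner (F : Finset I) (x u v : Ell2 I) :
    ⟪truncMul F u v, x⟫_ℂ =
      ∑ i ∈ F, ⟪u, stdBasis I i⟫_ℂ * ⟪v, stdBasis I i⟫_ℂ * ⟪stdBasis I i, x⟫_ℂ := by
  rw [← inner_conj_symm, inner_truncMul, map_sum]
  refine Finset.sum_congr rfl fun i _ => ?_
  simp only [map_mul, inner_conj_symm]
  ring

/-- The coordinates of v have modulus at most 1, so the product is dominated coordinatewise by u. -/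
theorem enorm_truncMul_le_one (F : Finset I) {u v : Ell2 I} (hu : ‖u‖ₑ ≤ 1) (hv : ‖v‖ₑ ≤ 1) :
    ‖truncMul F u v‖ₑ ^ 2 ≤ 1 := by
  rw [truncMul, enorm_sum_smul_stdBasis_sq]
  calc _ ≤ ∑ i ∈ F, ‖⟪stdBasis I i, u⟫_ℂ‖ₑ ^ 2 := by
        gcongr with i
        rw [enorm_mul]
        exact (mul_le_mul_right (enorm_inner_stdBasis_le_one hv i) _).trans (mul_one _).le
    _ ≤ ‖u‖ₑ ^ 2 := (ENNReal.sum_le_tsum F).trans (parseval_enorm (stdBasis I) u).le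
    _ ≤ 1 := pow_le_one₀ (by simp) hu

/-- The Bessel property survives because u_k v_l is a compression of u_k ⊗ v_l to the diagonal. In
coordinates, Bessel for v is used with k fixed, and then Bessel for u at each basis vector e_i gives
∑_k |⟪u_k, e_i⟫|² ≤ 1. -/
theorem tsum_inner_truncMul_le {κ ν : Type*} {u : κ → Ell2 I} {v : ν → Ell2 I}
    (hu : ∀ x, ∑' k, ‖⟪u k, x⟫_ℂ‖ₑ ^ 2 ≤ ‖x‖ₑ ^ 2)
    (hv : ∀ x, ∑' l, ‖⟪v l, x⟫_ℂ‖ₑ ^ 2 ≤ ‖x‖ₑ ^ 2) (F : Finset I) (x : Ell2 I) :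
    ∑' kl : κ × ν, ‖⟪x, truncMul F (u kl.1) (v kl.2)⟫_ℂ‖ₑ ^ 2 ≤ ‖x‖ₑ ^ 2 := by
  rw [ENNReal.tsum_prod' (f := fun kl : κ × ν => ‖⟪x, truncMul F (u kl.1) (v kl.2)⟫_ℂ‖ₑ ^ 2)]
  have h1 : ∀ k, ∑' l, ‖⟪x, truncMul F (u k) (v l)⟫_ℂ‖ₑ ^ 2 ≤
      ∑ i ∈ F, ‖⟪u k, stdBasis I i⟫_ℂ‖ₑ ^ 2 * ‖⟪stdBasis I i, x⟫_ℂ‖ₑ ^ 2 := by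
    intro k
    -- Multiplication by u_k is moved to the other side: ⟪u_k v_l, x⟫ = ⟪v_l, z⟫, where z is x
    -- multiplied coordinatewise by the conjugate of u_k and truncated to F.
    have := hv (∑ i ∈ F, (⟪u k, stdBasis I i⟫_ℂ * ⟪stdBasis I i, x⟫_ℂ) • stdBasis I i)
    rw [enorm_sum_smul_stdBasis_sq] at this
    simp_rw [← mul_pow, ← enorm_mul]
    refine le_trans (le_of_eq ?_) this
    refine tsum_congr fun l => ?_
    rw [enorm_inner_symm, truncMul_inner, inner_sum]
    congr 2
    refine Finset.sum_congr rfl fun i _ => ?_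
    rw [inner_smul_right]; ring
  calc _ ≤ ∑' k, ∑ i ∈ F, ‖⟪u k, stdBasis I i⟫_ℂ‖ₑ ^ 2 * ‖⟪stdBasis I i, x⟫_ℂ‖ₑ ^ 2 :=
        ENNReal.tsum_le_tsum h1
    _ = ∑ i ∈ F, (∑' k, ‖⟪u k, stdBasis I i⟫_ℂ‖ₑ ^ 2) * ‖⟪stdBasis I i, x⟫_ℂ‖ₑ ^ 2 := by
        rw [Summable.tsum_finsetSum fun _ _ => ENNReal.summable]
        simp_rw [ENNReal.tsum_mul_right]
    _ ≤ ∑ i ∈ F, ‖⟪stdBasis I i, x⟫_ℂ‖ₑ ^ 2 := by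
        gcongr with i
        refine (mul_le_mul_left ((hu _).trans ?_) _).trans (one_mul _).le
        rw [(stdBasis I).orthonormal.enorm_eq_one]; simp
    _ ≤ _ := (ENNReal.sum_le_tsum F).trans (parseval_enorm (stdBasis I) x).le

theorem inner_coordProj_apply_coordProj (F : Finset I) (E : Ell2 I →L[ℂ] Ell2 I) (x y : Ell2 I) :
    ⟪coordProj F y, E (coordProj F x)⟫_ℂ =
      ∑ i ∈ F, ∑ j ∈ F, opMatrix E i j * (⟪y, stdBasis I i⟫_ℂ * ⟪stdBasis I j, x⟫_ℂ) := by
  rw [coordProj_apply, coordProj_apply, map_sum, sum_inner]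
  refine Finset.sum_congr rfl fun i _ => ?_
  rw [inner_sum]
  refine Finset.sum_congr rfl fun j _ => ?_
  rw [map_smul, inner_smul_left, inner_smul_right, inner_conj_symm, opMatrix, Matrix.of_apply]
  ring

/-- Substitute the singular value expansions of both matrices into a_ij c_ij. Truncation to F makes
the sums over i and j finite, so they can be moved inside the series over k and l with no
summability question. -/
theorem enorm_inner_schurOp_le {κ ν : Type*} {A C : Ell2 I →L[ℂ] Ell2 I}
    {b : HilbertBasis κ ℂ (Ell2 I)} {s : κ → ℝ≥0} {u : κ → Ell2 I}
    (hu : ∀ k, A (b k) = ((s k : ℝ) : ℂ) • u k)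
    {d : HilbertBasis ν ℂ (Ell2 I)} {r : ν → ℝ≥0} {v : ν → Ell2 I}
    (hv : ∀ l, C (d l) = ((r l : ℝ) : ℂ) • v l) (F : Finset I) (x y : Ell2 I) :
    ‖⟪coordProj F y, schurOp A C (coordProj F x)⟫_ℂ‖ₑ ≤
      ∑' kl : κ × ν, (‖⟪y, truncMul F (u kl.1) (v kl.2)⟫_ℂ‖ₑ *
        ‖⟪x, truncMul F (b kl.1) (d kl.2)⟫_ℂ‖ₑ) * ((s kl.1 : ℝ≥0∞) * r kl.2) := by
  rw [inner_coordProj_apply_coordProj, opMatrix_schurOp]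
  have h1 : HasSum (fun k => ∑ i ∈ F, ∑ j ∈ F,
      ((s k : ℝ) : ℂ) * (⟪stdBasis I i, u k⟫_ℂ * ⟪b k, stdBasis I j⟫_ℂ) *
        (opMatrix C i j * (⟪y, stdBasis I i⟫_ℂ * ⟪stdBasis I j, x⟫_ℂ)))
      (∑ i ∈ F, ∑ j ∈ F, (opMatrix A ⊙ opMatrix C) i j *
        (⟪y, stdBasis I i⟫_ℂ * ⟪stdBasis I j, x⟫_ℂ)) := by
    refine hasSum_sum fun i _ => hasSum_sum fun j _ => ?_
    rw [Matrix.hadamard_apply, mul_assoc]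
    exact (hasSum_opMatrix hu i j).mul_right _
  have h2 : ∀ k, HasSum (fun l => ((s k : ℝ) : ℂ) * ((r l : ℝ) : ℂ) *
      (⟪y, truncMul F (u k) (v l)⟫_ℂ * ⟪truncMul F (b k) (d l), x⟫_ℂ))
      (∑ i ∈ F, ∑ j ∈ F,
        ((s k : ℝ) : ℂ) * (⟪stdBasis I i, u k⟫_ℂ * ⟪b k, stdBasis I j⟫_ℂ) *
        (opMatrix C i j * (⟪y, stdBasis I i⟫_ℂ * ⟪stdBasis I j, x⟫_ℂ))) := by
    intro k
    have : HasSum (fun l => ∑ i ∈ F, ∑ j ∈ F,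
        ((s k : ℝ) : ℂ) * (⟪stdBasis I i, u k⟫_ℂ * ⟪b k, stdBasis I j⟫_ℂ) *
        (((r l : ℝ) : ℂ) * (⟪stdBasis I i, v l⟫_ℂ * ⟪d l, stdBasis I j⟫_ℂ) *
          (⟪y, stdBasis I i⟫_ℂ * ⟪stdBasis I j, x⟫_ℂ)))
      (∑ i ∈ F, ∑ j ∈ F,
        ((s k : ℝ) : ℂ) * (⟪stdBasis I i, u k⟫_ℂ * ⟪b k, stdBasis I j⟫_ℂ) *
        (opMatrix C i j * (⟪y, stdBasis I i⟫_ℂ * ⟪stdBasis I j, x⟫_ℂ))) :=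
      hasSum_sum fun i _ => hasSum_sum fun j _ =>
        ((hasSum_opMatrix hv i j).mul_right _).mul_left _
    refine this.congr_fun fun l => ?_
    -- For fixed k and l the summand is a function of i times a function of j, so the double sum
    -- over F splits into the two inner products.
    rw [inner_truncMul, truncMul_inner, Finset.sum_mul_sum, Finset.mul_sum]
    refine Finset.sum_congr rfl fun i _ => ?_
    rw [Finset.mul_sum]
    refine Finset.sum_congr rfl fun j _ => ?_
    ring
  have hreal : ∀ a : ℝ≥0, ‖((a : ℝ) : ℂ)‖ₑ = a := fun a => by
    rw [← ofReal_norm]; simp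
  rw [← h1.tsum_eq, ENNReal.tsum_prod' (f := fun kl : κ × ν =>
    (‖⟪y, truncMul F (u kl.1) (v kl.2)⟫_ℂ‖ₑ *
      ‖⟪x, truncMul F (b kl.1) (d kl.2)⟫_ℂ‖ₑ) * ((s kl.1 : ℝ≥0∞) * r kl.2))]
  refine enorm_tsum_le_tsum_enorm.trans (ENNReal.tsum_le_tsum fun k => ?_)
  rw [← (h2 k).tsum_eq]
  refine enorm_tsum_le_tsum_enorm.trans (ENNReal.tsum_le_tsum fun l => ?_)
  rw [enorm_mul, enorm_mul, enorm_mul, hreal, hreal, enorm_inner_symm x, mul_comm]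

theorem ennreal_mul_le_half_add_sq (a b : ℝ≥0∞) : a * b ≤ 2⁻¹ * (a ^ 2 + b ^ 2) := by
  have h := ENNReal.young_inequality a b Real.HolderConjugate.two_two
  refine h.trans (le_of_eq ?_)
  simp only [ENNReal.rpow_two, div_eq_mul_inv]
  rw [show ENNReal.ofReal 2 = 2 by simp]
  ring

theorem ennreal_half_mul_two : (2⁻¹ : ℝ≥0∞) * (1 + 1) = 1 := by
  rw [one_add_one_eq_two]; exact ENNReal.inv_mul_cancel (by simp) (by simp)

/-- By the arithmetic-geometric mean inequality, each coefficient of s_k r_l is at most a weight w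
whose sums over (k, l) and over t are all at most 1. Jensen's inequality uses the first bound; after
exchanging the sums, the second one removes the weights. -/
theorem tsum_inner_coordProj_schurOp_le {κ ν τ : Type*} {A C : Ell2 I →L[ℂ] Ell2 I}
    {b : HilbertBasis κ ℂ (Ell2 I)} {s : κ → ℝ≥0} (hs : SingularSystem A b s)
    {d : HilbertBasis ν ℂ (Ell2 I)} {r : ν → ℝ≥0} (hr : SingularSystem C d r)
    {e f : τ → Ell2 I} (he : Orthonormal ℂ e) (hf : Orthonormal ℂ f) {p : ℝ} (hp : 1 ≤ p)
    (F : Finset I) :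
    ∑' t, ‖⟪coordProj F (f t), schurOp A C (coordProj F (e t))⟫_ℂ‖ₑ ^ p ≤
      (∑' k, (s k : ℝ≥0∞) ^ p) * ∑' l, (r l : ℝ≥0∞) ^ p := by
  obtain ⟨u, hu, hu1, hub⟩ := hs.exists_left
  obtain ⟨v, hv, hv1, hvb⟩ := hr.exists_left
  let w : τ → κ × ν → ℝ≥0∞ := fun t kl => 2⁻¹ *
    (‖⟪f t, truncMul F (u kl.1) (v kl.2)⟫_ℂ‖ₑ ^ 2 + ‖⟪e t, truncMul F (b kl.1) (d kl.2)⟫_ℂ‖ₑ ^ 2)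
  have hw1 : ∀ t, ∑' kl, w t kl ≤ 1 := by
    intro t
    simp only [w]
    rw [ENNReal.tsum_mul_left, ENNReal.tsum_add, ← ennreal_half_mul_two]
    gcongr
    · refine (tsum_inner_truncMul_le hub hvb F _).trans ?_
      rw [hf.enorm_eq_one]; simp
    · refine (tsum_inner_truncMul_le (bessel_enorm b.orthonormal) (bessel_enorm d.orthonormal)
        F _).trans ?_
      rw [he.enorm_eq_one]; simp
  have hw2 : ∀ kl, ∑' t, w t kl ≤ 1 := by
    intro kl
    simp only [w]
    rw [ENNReal.tsum_mul_left, ENNReal.tsum_add, ← ennreal_half_mul_two]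
    gcongr
    · exact (bessel_enorm hf _).trans (enorm_truncMul_le_one F (hu1 _) (hv1 _))
    · exact (bessel_enorm he _).trans (enorm_truncMul_le_one F
        (b.orthonormal.enorm_eq_one _).le (d.orthonormal.enorm_eq_one _).le)
  calc _ ≤ ∑' t, (∑' kl : κ × ν, w t kl * ((s kl.1 : ℝ≥0∞) * r kl.2)) ^ p := by
        refine ENNReal.tsum_le_tsum fun t => ?_
        gcongr
        refine (enorm_inner_schurOp_le hu hv F (e t) (f t)).trans ?_
        gcongr
        exact ennreal_mul_le_half_add_sq _ _
    _ ≤ ∑' t, ∑' kl : κ × ν, w t kl * ((s kl.1 : ℝ≥0∞) * r kl.2) ^ p :=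
        ENNReal.tsum_le_tsum fun t => ennreal_sum_wt_le hp _ _ (hw1 t)
    _ = ∑' kl : κ × ν, (∑' t, w t kl) * ((s kl.1 : ℝ≥0∞) * r kl.2) ^ p := by
        rw [ENNReal.tsum_comm]
        simp_rw [ENNReal.tsum_mul_right]
    _ ≤ ∑' kl : κ × ν, ((s kl.1 : ℝ≥0∞) * r kl.2) ^ p := by
        refine ENNReal.tsum_le_tsum fun kl => ?_
        exact (mul_le_mul_left (hw2 kl) _).trans (one_mul _).le
    _ = _ := by
        -- The p-th powers of the products s_k r_l sum to the product of the two sums.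
        rw [ENNReal.tsum_prod' (f := fun kl : κ × ν => ((s kl.1 : ℝ≥0∞) * r kl.2) ^ p)]
        simp_rw [ENNReal.mul_rpow_of_nonneg _ _ (zero_le_one.trans hp), ENNReal.tsum_mul_left,
          ENNReal.tsum_mul_right]

/-- The truncated bound does not depend on F, so F can grow to I in every finite partial sum over t.
-/
theorem tsum_inner_schurOp_le {κ ν τ : Type*} {A C : Ell2 I →L[ℂ] Ell2 I}
    {b : HilbertBasis κ ℂ (Ell2 I)} {s : κ → ℝ≥0} (hs : SingularSystem A b s)
    {d : HilbertBasis ν ℂ (Ell2 I)} {r : ν → ℝ≥0} (hr : SingularSystem C d r)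
    {e f : τ → Ell2 I} (he : Orthonormal ℂ e) (hf : Orthonormal ℂ f) {p : ℝ} (hp : 1 ≤ p) :
    ∑' t, ‖⟪f t, schurOp A C (e t)⟫_ℂ‖ₑ ^ p ≤
      (∑' k, (s k : ℝ≥0∞) ^ p) * ∑' l, (r l : ℝ≥0∞) ^ p := by
  rw [ENNReal.tsum_eq_iSup_sum]
  refine iSup_le fun T => ?_
  have hlim : Filter.Tendsto (fun F : Finset I =>
      ∑ t ∈ T, ‖⟪coordProj F (f t), schurOp A C (coordProj F (e t))⟫_ℂ‖ₑ ^ p) Filter.atTop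
      (nhds (∑ t ∈ T, ‖⟪f t, schurOp A C (e t)⟫_ℂ‖ₑ ^ p)) := by
    refine tendsto_finsetSum _ fun t _ => ?_
    refine ((ENNReal.continuous_rpow_const (y := p)).tendsto _).comp ?_
    refine (continuous_enorm.tendsto _).comp ?_
    exact (tendsto_coordProj_apply (f t)).inner
      (((schurOp A C).continuous.tendsto _).comp (tendsto_coordProj_apply (e t)))
  exact le_of_tendsto' hlim fun F => (ENNReal.sum_le_tsum T).trans
    (tsum_inner_coordProj_schurOp_le hs hr he hf hp F)

/-- The case of the operator norm is needed too, since it is the dual exponent when p = 1. For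
finite p, the Schatten norm of A * C is attained on a pair of orthonormal families, to which the
preceding estimate applies. -/
theorem schattenENorm_schurOp_le {p : ℝ≥0∞} [Fact (1 ≤ p)] {A C : Ell2 I →L[ℂ] Ell2 I}
    (hA : IsCompactOperator A) (hC : IsCompactOperator C) :
    schattenENorm p (schurOp A C) ≤ schattenENorm p A * schattenENorm p C := by
  by_cases h : p = ∞
  · subst h
    simp only [schattenENorm_top]
    rw [← ofReal_norm, ← ofReal_norm, ← ofReal_norm, ← ENNReal.ofReal_mul (norm_nonneg _)]
    exact ENNReal.ofReal_le_ofReal (norm_schurOp_le A C)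
  · have hp := one_le_toReal_of_fact h
    obtain ⟨κ, b, s, hs⟩ := exists_singularSystem A hA
    obtain ⟨ν, d, r, hr⟩ := exists_singularSystem C hC
    obtain ⟨σ, c, q, hq⟩ := exists_singularSystem _ (isCompactOperator_schurOp hA C)
    obtain ⟨e, f, he, hf, hef⟩ := hq.exists_attain (p := p.toReal) (by linarith)
    rw [schattenENorm_eq_of_singularSystem h hs, schattenENorm_eq_of_singularSystem h hr,
      schattenENorm_eq_of_singularSystem h hq, hef, ← ENNReal.mul_rpow_of_nonneg _ _ (by positivity)]
    gcongr
    exact tsum_inner_schurOp_le hs hr he hf hp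

end SchurSchatten

/-! ### Schur products on Schatten classes and on their projective tensor product -/

section SchurAlgebra

namespace SchattenClass

variable {I : Type*} {p : ℝ≥0∞} [Fact (1 ≤ p)]

theorem toMatrix_injective : Function.Injective (toMatrix : SchattenClass I p → Matrix I I ℂ) :=
  fun _ _ h => Subtype.val_injective (opMatrix_injective h)

theorem toMatrix_add (A B : SchattenClass I p) : (A + B).toMatrix = A.toMatrix + B.toMatrix := by
  ext i j
  exact (entry i j).map_add A B

theorem toMatrix_smul (c : ℂ) (A : SchattenClass I p) : (c • A).toMatrix = c • A.toMatrix := by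
  ext i j
  exact (entry i j).map_smul c A

/-- The Schur product of two elements of a Schatten class. -/
noncomputable def schur (A B : SchattenClass I p) : SchattenClass I p :=
  (⟨schurOp (toOp A) (toOp B), isCompactOperator_schurOp A.isCompactOperator _,
    (schattenENorm_schurOp_le A.isCompactOperator B.isCompactOperator).trans_lt
      (ENNReal.mul_lt_top A.schattenENorm_lt_top B.schattenENorm_lt_top)⟩ : schattenSubmodule I p)

theorem toMatrix_schur (A B : SchattenClass I p) :
    (schur A B).toMatrix = A.toMatrix ⊙ B.toMatrix :=
  opMatrix_schurOp _ _

theorem norm_schur_le (A B : SchattenClass I p) : ‖schur A B‖ ≤ ‖A‖ * ‖B‖ := by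
  rw [norm_def, norm_def, norm_def, ← ENNReal.toReal_mul]
  exact ENNReal.toReal_mono
    (ENNReal.mul_lt_top A.schattenENorm_lt_top B.schattenENorm_lt_top).ne
    (schattenENorm_schurOp_le A.isCompactOperator B.isCompactOperator)

/-- The Schur product on a Schatten class, as a bounded bilinear map. -/
noncomputable def schurL : SchattenClass I p →L[ℂ] SchattenClass I p →L[ℂ] SchattenClass I p :=
  (LinearMap.mk₂ ℂ schur
    (fun A B C => toMatrix_injective <| by
      simp only [toMatrix_schur, toMatrix_add, Matrix.add_hadamard])
    (fun c A B => toMatrix_injective <| by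
      simp only [toMatrix_schur, toMatrix_smul, Matrix.smul_hadamard])
    (fun A B C => toMatrix_injective <| by
      simp only [toMatrix_schur, toMatrix_add, Matrix.hadamard_add])
    (fun c A B => toMatrix_injective <| by
      simp only [toMatrix_schur, toMatrix_smul, Matrix.hadamard_smul])).mkContinuous₂ 1
    fun A B => by simpa using norm_schur_le A B

theorem norm_schurL_le : ‖(schurL : SchattenClass I p →L[ℂ] _)‖ ≤ 1 :=
  LinearMap.mkContinuous₂_norm_le _ zero_le_one _

theorem entry_schurL (A B : SchattenClass I p) (i j : I) :
    entry i j (schurL A B) = entry i j A * entry i j B :=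
  congrFun (congrFun (toMatrix_schur A B) i) j

end SchattenClass

/-- The extension is made one variable at a time: each `f x` extends to an operator on Y, and the
resulting map from X to operators on Y is extended in turn. Uniqueness of extensions gives linearity
in x, and density carries the norm bound over with the same constant. -/
theorem exists_bilinear_extension {X Y : Type*} [SeminormedAddCommGroup X] [NormedSpace ℂ X]
    [NormedAddCommGroup Y] [NormedSpace ℂ Y] [CompleteSpace Y] (ι : X →L[ℂ] Y)
    (hd : DenseRange ι) (hn : ∀ x, ‖ι x‖ = ‖x‖) (f : X →L[ℂ] X →L[ℂ] X)
    (hf : ∀ x y, ‖f x y‖ ≤ ‖x‖ * ‖y‖) :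
    ∃ g : Y →L[ℂ] Y →L[ℂ] Y,
      (∀ x y, g (ι x) (ι y) = ι (f x y)) ∧ ∀ u v, ‖g u v‖ ≤ ‖u‖ * ‖v‖ := by
  have hi : IsUniformInducing ι :=
    (AddMonoidHomClass.isometry_of_norm ι hn).isUniformInducing
  have hadd : ∀ x y, (ι ∘L f (x + y)).extend ι = (ι ∘L f x).extend ι + (ι ∘L f y).extend ι := by
    intro x y
    refine ContinuousLinearMap.extend_unique _ hd hi _ ?_
    ext z
    simp [ContinuousLinearMap.extend_eq _ hd hi]
  have hsmul : ∀ (c : ℂ) x, (ι ∘L f (c • x)).extend ι = c • (ι ∘L f x).extend ι := by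
    intro c x
    refine ContinuousLinearMap.extend_unique _ hd hi _ ?_
    ext z
    simp [ContinuousLinearMap.extend_eq _ hd hi]
  have hle : ∀ x, ‖(ι ∘L f x).extend ι‖ ≤ 1 * ‖x‖ := by
    intro x
    refine ContinuousLinearMap.opNorm_le_bound _ (by positivity) fun u => ?_
    induction u using hd.induction_on with
    | hp => exact isClosed_le (by fun_prop) (by fun_prop)
    | ih y =>
      rw [ContinuousLinearMap.extend_eq _ hd hi, ContinuousLinearMap.comp_apply, hn, hn, one_mul]
      exact hf x y
  let l : X →ₗ[ℂ] Y →L[ℂ] Y :=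
    { toFun := fun x => (ι ∘L f x).extend ι, map_add' := hadd, map_smul' := hsmul }
  let h : X →L[ℂ] Y →L[ℂ] Y := l.mkContinuous 1 hle
  have hg : ∀ x y, (h.extend ι) (ι x) (ι y) = ι (f x y) := fun x y => by
    rw [ContinuousLinearMap.extend_eq _ hd hi]
    exact ContinuousLinearMap.extend_eq _ hd hi y
  refine ⟨h.extend ι, hg, fun u v => ?_⟩
  induction u, v using hd.induction_on₂ with
  | hp => exact isClosed_le (by fun_prop) (by fun_prop)
  | h x y =>
    rw [hg, hn, hn, hn]
    exact hf x y

/-- The factorwise product on the tensor product of a family of spaces with bounded bilinear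
products. -/
noncomputable def tensorMulL {ι : Type*} [Fintype ι] {E : ι → Type*}
    [∀ k, SeminormedAddCommGroup (E k)] [∀ k, NormedSpace ℂ (E k)]
    (m : ∀ k, E k →L[ℂ] E k →L[ℂ] E k) :
    (⨂[ℂ] k, E k) →L[ℂ] (⨂[ℂ] k, E k) →L[ℂ] ⨂[ℂ] k, E k :=
  PiTensorProduct.liftIsometry ℂ E _
    ((PiTensorProduct.mapLMultilinear ℂ E E).compContinuousLinearMap m)

theorem tensorMulL_tprod {ι : Type*} [Fintype ι] {E : ι → Type*}
    [∀ k, SeminormedAddCommGroup (E k)] [∀ k, NormedSpace ℂ (E k)]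
    (m : ∀ k, E k →L[ℂ] E k →L[ℂ] E k) (x y : ∀ k, E k) :
    tensorMulL m (PiTensorProduct.tprod ℂ x) (PiTensorProduct.tprod ℂ y) =
      PiTensorProduct.tprod ℂ fun k => m k (x k) (y k) := by
  rw [tensorMulL, PiTensorProduct.liftIsometry_apply_apply, PiTensorProduct.lift.tprod]
  exact PiTensorProduct.map_tprod _ _

-- This is where the projective norm enters: lifting a multilinear map to the tensor product
-- preserves its norm. It remains to bound the map (T_k) ↦ ⨂ T_k composed with the m_k, and each of
-- these has norm at most 1.
set_option maxSynthPendingDepth 3 in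
theorem norm_tensorMulL_apply_le {ι : Type*} [Fintype ι] {E : ι → Type*}
    [∀ k, SeminormedAddCommGroup (E k)] [∀ k, NormedSpace ℂ (E k)]
    (m : ∀ k, E k →L[ℂ] E k →L[ℂ] E k) (hm : ∀ k, ‖m k‖ ≤ 1) (x y : ⨂[ℂ] k, E k) :
    ‖tensorMulL m x y‖ ≤ ‖x‖ * ‖y‖ := by
  have h : ‖tensorMulL m‖ ≤ 1 := by
    rw [tensorMulL, LinearIsometryEquiv.norm_map]
    refine (ContinuousMultilinearMap.norm_compContinuousLinearMap_le _ _).trans ?_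
    refine mul_le_one₀ PiTensorProduct.opNorm_mapLMultilinear_le (by positivity) ?_
    exact Finset.prod_le_one (fun _ _ => norm_nonneg _) fun k _ => hm k
  refine ((tensorMulL m).le_opNorm₂ x y).trans ?_
  rw [mul_assoc]
  exact mul_le_of_le_one_left (by positivity) h

variable (I : Type*) (p : ℝ≥0∞) [Fact (1 ≤ p)]

/-- The factorwise Schur product on the algebraic tensor product. -/
noncomputable def tensorSchurL :
    (⨂[ℂ] k : Fin 2, SchattenClass I (dualPair p k)) →L[ℂ]
      (⨂[ℂ] k : Fin 2, SchattenClass I (dualPair p k)) →L[ℂ]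
        ⨂[ℂ] k : Fin 2, SchattenClass I (dualPair p k) :=
  tensorMulL fun _ => SchattenClass.schurL

theorem tensorSchurL_tprod (m n : ∀ k : Fin 2, SchattenClass I (dualPair p k)) :
    tensorSchurL I p (PiTensorProduct.tprod ℂ m) (PiTensorProduct.tprod ℂ n) =
      PiTensorProduct.tprod ℂ fun k => SchattenClass.schurL (m k) (n k) :=
  tensorMulL_tprod _ m n

theorem norm_tensorSchurL_apply_le (x y : ⨂[ℂ] k : Fin 2, SchattenClass I (dualPair p k)) :
    ‖tensorSchurL I p x y‖ ≤ ‖x‖ * ‖y‖ :=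
  norm_tensorMulL_apply_le _ (fun _ => SchattenClass.norm_schurL_le) x y

theorem schurEntry_tprod (i j : I) (m : ∀ k : Fin 2, SchattenClass I (dualPair p k)) :
    schurEntry I p i j (PiTensorProduct.tprod ℂ m) =
      SchattenClass.entry i j (m 0) * SchattenClass.entry i j (m 1) := by
  simp [schurEntry, Fin.prod_univ_two]

/-- Both sides are bilinear, so elementary tensors suffice, where the claim is (a_ij c_ij)(b_ij
d_ij) = (a_ij b_ij)(c_ij d_ij). -/
theorem schurEntry_tensorSchurL (i j : I)
    (x y : ⨂[ℂ] k : Fin 2, SchattenClass I (dualPair p k)) :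
    schurEntry I p i j (tensorSchurL I p x y) = schurEntry I p i j x * schurEntry I p i j y := by
  induction x using PiTensorProduct.induction_on with
  | add x₁ x₂ h₁ h₂ => simp only [map_add, add_apply, h₁, h₂, add_mul]
  | smul_tprod c m =>
    induction y using PiTensorProduct.induction_on with
    | add y₁ y₂ h₁ h₂ => simp only [map_add, h₁, h₂, mul_add]
    | smul_tprod c' n =>
      simp only [map_smul, smul_apply, tensorSchurL_tprod, schurEntry_tprod,
        SchattenClass.entry_schurL, smul_eq_mul]
      ring

variable {I p}

theorem continuous_schurMap_apply (i j : I) :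
    Continuous fun u : SchattenProjTensor I p => schurMap I p u i j :=
  ((schurEntry I p i j).extend (UniformSpace.Completion.toComplL (𝕜 := ℂ))).continuous

/-- The witness is the extended tensor product multiplication. Each entry of both sides is
continuous in (u, v), so the identity passes from the algebraic tensor product to its completion. -/
theorem exists_schurMap_eq_hadamard (u v : SchattenProjTensor I p) :
    ∃ w : SchattenProjTensor I p,
      schurMap I p w = schurMap I p u ⊙ schurMap I p v ∧ ‖w‖ ≤ ‖u‖ * ‖v‖ := by
  obtain ⟨g, hg, hn⟩ := exists_bilinear_extension
    (UniformSpace.Completion.toComplL (𝕜 := ℂ)) UniformSpace.Completion.denseRange_coe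
    UniformSpace.Completion.norm_coe _ (norm_tensorSchurL_apply_le I p)
  refine ⟨g u v, ?_, hn u v⟩
  ext i j
  rw [Matrix.hadamard_apply]
  induction u, v using UniformSpace.Completion.induction_on₂ with
  | hp =>
    have := continuous_schurMap_apply (p := p) i j
    exact isClosed_eq (this.comp (by fun_prop))
      ((this.comp continuous_fst).mul (this.comp continuous_snd))
  | ih x y =>
    rw [show g x y = tensorSchurL I p x y from hg x y, schurMap_coe, schurMap_coe, schurMap_coe, schurEntry_tensorSchurL]

/-! ### Descent to the quotient and the Banach algebra structure -/

namespace SchurPredual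

theorem toMatrix_injective : Function.Injective (toMatrix : SchurPredual I p →ₗ[ℂ] _) :=
  Subtype.val_injective

theorem equivQuotient_eq_mk {A : SchurPredual I p} {u : SchattenProjTensor I p}
    (h : schurMap I p u = A.toMatrix) : equivQuotient I p A = Submodule.Quotient.mk u := by
  refine (equivQuotient I p).symm.injective ?_
  rw [LinearEquiv.symm_apply_apply]
  exact toMatrix_injective h.symm

theorem norm_le_of_schurMap_eq {A : SchurPredual I p} {u : SchattenProjTensor I p}
    (h : schurMap I p u = A.toMatrix) : ‖A‖ ≤ ‖u‖ := by
  change ‖equivQuotient I p A‖ ≤ ‖u‖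
  rw [equivQuotient_eq_mk h]
  exact Submodule.Quotient.norm_mk_le _ _

/-- The quotient norm is an infimum over preimages, in general only approached, hence the ε. -/
theorem exists_schurMap_eq (A : SchurPredual I p) {ε : ℝ} (hε : 0 < ε) :
    ∃ u : SchattenProjTensor I p, schurMap I p u = A.toMatrix ∧ ‖u‖ < ‖A‖ + ε := by
  obtain ⟨u, hu, hlt⟩ := Submodule.Quotient.norm_mk_lt (equivQuotient I p A) hε
  refine ⟨u, ?_, hlt⟩
  have h := congrArg (fun q => toMatrix ((equivQuotient I p).symm q)) hu
  simp only [LinearEquiv.symm_apply_apply] at h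
  exact h

instance : CompleteSpace (SchurPredual I p) := by
  -- The norm is transported along this bijection, so completeness is that of a Banach space modulo
  -- a closed subspace.
  have h : Isometry (equivQuotient I p) :=
    AddMonoidHomClass.isometry_of_norm _ fun _ => rfl
  exact (h.isUniformInducing.completeSpace_congr (equivQuotient I p).surjective).2 inferInstance

theorem hadamard_mem_range (A B : SchurPredual I p) :
    A.toMatrix ⊙ B.toMatrix ∈ LinearMap.range (schurMap I p) := by
  obtain ⟨u, hu, -⟩ := A.exists_schurMap_eq one_pos
  obtain ⟨v, hv, -⟩ := B.exists_schurMap_eq one_pos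
  obtain ⟨w, hw, -⟩ := exists_schurMap_eq_hadamard u v
  exact ⟨w, by rw [hw, hu, hv]⟩

/-- The Schur product on `R_p^I`. -/
noncomputable def schur (A B : SchurPredual I p) : SchurPredual I p :=
  (⟨A.toMatrix ⊙ B.toMatrix, hadamard_mem_range A B⟩ : LinearMap.range (schurMap I p))

theorem toMatrix_schur (A B : SchurPredual I p) :
    (schur A B).toMatrix = A.toMatrix ⊙ B.toMatrix := rfl

/-- Multiply near-optimal preimages of A and B: their product is a preimage of the Schur product,
which bounds its quotient norm. Then let ε tend to 0. -/
theorem norm_schur_le (A B : SchurPredual I p) : ‖schur A B‖ ≤ ‖A‖ * ‖B‖ := by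
  have key : ∀ ε > 0, ‖schur A B‖ ≤ (‖A‖ + ε) * (‖B‖ + ε) := by
    intro ε hε
    obtain ⟨u, hu, hun⟩ := A.exists_schurMap_eq hε
    obtain ⟨v, hv, hvn⟩ := B.exists_schurMap_eq hε
    obtain ⟨w, hw, hwn⟩ := exists_schurMap_eq_hadamard u v
    calc _ ≤ ‖w‖ := norm_le_of_schurMap_eq (by rw [hw, hu, hv, toMatrix_schur])
      _ ≤ ‖u‖ * ‖v‖ := hwn
      _ ≤ _ := by gcongr
  have hlim : Filter.Tendsto (fun ε : ℝ => (‖A‖ + ε) * (‖B‖ + ε)) (nhdsWithin 0 (Set.Ioi 0))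
      (nhds (‖A‖ * ‖B‖)) := by
    have : Continuous fun ε : ℝ => (‖A‖ + ε) * (‖B‖ + ε) := by fun_prop
    simpa using (this.tendsto 0).mono_left nhdsWithin_le_nhds
  exact ge_of_tendsto hlim (eventually_nhdsWithin_of_forall key)

theorem isCommBanachAlgebra_schur : IsCommBanachAlgebra (SchurPredual I p) schur where
  complete := inferInstance
  add_mul a b c := toMatrix_injective <| by
    simp only [toMatrix_schur, map_add, Matrix.add_hadamard]
  mul_add a b c := toMatrix_injective <| by
    simp only [toMatrix_schur, map_add, Matrix.hadamard_add]
  smul_mul z a b := toMatrix_injective <| by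
    simp only [toMatrix_schur, map_smul, Matrix.smul_hadamard]
  mul_smul z a b := toMatrix_injective <| by
    simp only [toMatrix_schur, map_smul, Matrix.hadamard_smul]
  mul_assoc a b c := toMatrix_injective <| by
    simp only [toMatrix_schur, Matrix.hadamard_assoc]
  mul_comm a b := toMatrix_injective <| Matrix.hadamard_comm _ _
  norm_mul_le := norm_schur_le

end SchurPredual

end SchurAlgebra

theorem mainTheorem6 (I : Type*) (p : ℝ≥0∞) [Fact (1 ≤ p)] (hp : p ≠ ∞) :
    ∃ mul : SchurPredual I p → SchurPredual I p → SchurPredual I p,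
      (∀ A B, (mul A B).toMatrix = A.toMatrix ⊙ B.toMatrix) ∧
        IsCommBanachAlgebra (SchurPredual I p) mul :=
  ⟨SchurPredual.schur, SchurPredual.toMatrix_schur, SchurPredual.isCommBanachAlgebra_schur⟩
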